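/- Let $G$ be a countably infinite (discrete) group. A $G$-flow is an action of $G$ by homeomorphisms on a compact Hausdorff space; it is minimal if it is non-empty and every orbit is dense, and free if $gy\neq y$ for every point $y$ and every $g\in G\setminus\{1_G\}$. A family $\{Y_i : i\in I\}$ of minimal $G$-flows is mutually disjoint if the product $\prod_{i\in I}Y_i$, with the product topology and the diagonal action, is minimal. A $G$-system $(X,\mu)$ is an action of $G$ by Borel, measure-preserving bijections on a standard Borel probability space; it is free if $\mu$-almost every $x\in X$ has trivial stabilizer. Two $G$-systems $(X,\mu)$ and $(Y,\nu)$ are isomorphic if there are a $G$-invariant Borel set $X'\subseteq X$ with $\mu(X')=1$ and an injective, $G$-equivariant Borel map $f\colon X'\to Y$ such that $\nu$ is the push-forward of $\mu$ under $f$. A metrizable $G$-flow $Y$ is model-universal if for every free $G$-system $(X,\mu)$ there is a $G$-invariant Borel probability measure $\nu$ on $Y$ such that $(X,\mu)$ and $(Y,\nu)$ are isomorphic. Theorem. For every countably infinite group $G$ there is a mutually disjoint family $\{Y_i : i<\mathfrak{c}\}$, indexed by the cardinal $\mathfrak{c}=2^{\aleph_0}$, of free, minimal, model-universal $G$-flows.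 -/

import Mathlib

open MeasureTheory

/-- A `G`-flow: an action of the (discrete) group `G` by homeomorphisms on a compact
Hausdorff space. -/
structure GFlow.{u, v} (G : Type u) [Group G] where
  /-- The underlying space. -/
  carrier : Type v
  [topologicalSpace : TopologicalSpace carrier]
  [compactSpace : CompactSpace carrier]
  [t2Space : T2Space carrier]
  [mulAction : MulAction G carrier]
  [continuousConstSMul : ContinuousConstSMul G carrier]

attribute [instance] GFlow.topologicalSpace GFlow.compactSpace GFlow.t2Space
  GFlow.mulAction GFlow.continuousConstSMul

/-- The underlying space of a flow carries its Borel `σ`-algebra. -/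
instance GFlow.instMeasurableSpace.{u, v} {G : Type u} [Group G] (Y : GFlow.{u, v} G) :
    MeasurableSpace Y.carrier :=
  borel Y.carrier

instance GFlow.instBorelSpace.{u, v} {G : Type u} [Group G] (Y : GFlow.{u, v} G) :
    BorelSpace Y.carrier :=
  ⟨rfl⟩

/-- The product of a family of flows, with the product topology and the diagonal action. -/
def GFlow.pi.{u, v, w} {G : Type u} [Group G] {I : Type w} (Y : I → GFlow.{u, v} G) :
    GFlow.{u, max w v} G where
  carrier := ∀ i, (Y i).carrier

/-- A flow is minimal if it is non-empty and every orbit is dense. -/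
def GFlow.IsMinimal.{u, v} {G : Type u} [Group G] (Y : GFlow.{u, v} G) : Prop :=
  Nonempty Y.carrier ∧ ∀ y : Y.carrier, Dense (MulAction.orbit G y)

/-- A flow is free if no non-identity group element fixes a point. -/
def GFlow.IsFree.{u, v} {G : Type u} [Group G] (Y : GFlow.{u, v} G) : Prop :=
  ∀ (y : Y.carrier) (g : G), g ≠ 1 → g • y ≠ y

/-- A family of minimal flows is mutually disjoint if its product is minimal. -/
def GFlow.MutuallyDisjoint.{u, v, w} {G : Type u} [Group G] {I : Type w}
    (Y : I → GFlow.{u, v} G) : Prop :=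
  (∀ i, (Y i).IsMinimal) ∧ (GFlow.pi Y).IsMinimal

/-- `(X, μ)` is a `G`-system: `X` is a standard Borel space, `μ` is a probability measure on it,
and `G` acts by measurable, measure-preserving bijections. -/
structure IsGSystem.{u, w} (G : Type u) [Group G] (X : Type w) [MeasurableSpace X]
    [MulAction G X] (μ : Measure X) : Prop where
  standardBorel : StandardBorelSpace X
  isProbabilityMeasure : IsProbabilityMeasure μ
  measurePreserving : ∀ g : G, MeasurePreserving (fun x : X => g • x) μ μ

/-- `(X, μ)` is a free `G`-system: almost every point has trivial stabilizer. -/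
structure IsFreeGSystem.{u, w} (G : Type u) [Group G] (X : Type w) [MeasurableSpace X]
    [MulAction G X] (μ : Measure X) : Prop extends IsGSystem G X μ where
  ae_stabilizer_eq_bot : ∀ᵐ x ∂μ, MulAction.stabilizer G x = ⊥

/-- `(X, μ)` and `(Y, ν)` are isomorphic: there are a `G`-invariant Borel set `X' ⊆ X` of full
measure and a Borel map to `Y` which is `G`-equivariant and injective on `X'` and pushes `μ`
forward to `ν`. The values of `f` outside the conull set `X'` play no role. -/
def IsomorphicGSystems.{u, w, v} (G : Type u) [Group G]
    {X : Type w} [MeasurableSpace X] [MulAction G X] (μ : Measure X)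
    {Y : Type v} [MeasurableSpace Y] [MulAction G Y] (ν : Measure Y) : Prop :=
  ∃ (X' : Set X) (f : X → Y),
    MeasurableSet X' ∧ μ X' = 1 ∧ (∀ (g : G), ∀ x ∈ X', g • x ∈ X') ∧
    Measurable f ∧ (∀ (g : G), ∀ x ∈ X', f (g • x) = g • f x) ∧ Set.InjOn f X' ∧
    ν = μ.map f

/-- A flow `Y` is model-universal if it is metrizable and every free `G`-system is isomorphic to
`(Y, ν)` for some invariant Borel probability measure `ν` on `Y`. -/
def GFlow.ModelUniversal.{u, v, w} {G : Type u} [Group G] (Y : GFlow.{u, v} G) : Prop :=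
  TopologicalSpace.MetrizableSpace Y.carrier ∧
  ∀ (X : Type w) [MeasurableSpace X] [MulAction G X] (μ : Measure X),
    IsFreeGSystem G X μ →
    ∃ ν : Measure Y.carrier, IsGSystem G Y.carrier ν ∧ IsomorphicGSystems G μ ν

universe u v w

/-!
The flows are intersections of decreasing sequences of subshifts of finite type ("stages") in the
space of configurations `G → ℕ → Bool × Bool`: at every group element there are countably many
tracks, each with a data bit and a marker bit, and the `n`-th stage constrains only the first `n`
tracks. The next stage (`stepSet`) asks that the markers of track `n` form a maximal `D`-spaced
subset of `G` and that a prescribed pattern of the current stage be seen on `F * s` for every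
marker `s`. If `D` is large compared with `F`, stages keep the property that finite patterns can
be written over any configuration with a change inside a bounded margin
(`IsStage.exists_patch_stepSet`).

*Universality.* A free system has an injective Borel labelling that stores every bit on infinitely
many tracks. In a free Borel action maximal `D`-spaced Borel sets exist
(`Spaced.exists_measurableSet_maxSpaced`), they have measure at most `1 / |B|` if `D` contains the
quotients of `B`, and so the labelling can be pushed into the next stage by changing the first `n`
tracks only on a set of measure at most `2⁻ⁿ`, and the data on the other tracks not at all
(`IsStage.refines_stepSet`). By Borel–Cantelli the labellings converge almost everywhere, and the
limit still determines the point, because all but finitely many of its data bits are the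
original ones (`exists_measurable_injOn`).

*Minimality and disjointness.* The stages form a binary tree, and the flows are its branches. At
each even level the finitely many nodes are refined so that any family of their patterns occurs at
a common place in any family of points (`exists_rich_refinement`), which makes every finite product
of distinct branches, hence the full product, minimal. This goes by induction on the number of
nodes. Suppose that `T` is a sparse finite set such that the patterns of the previous nodes always
occur jointly somewhere in `T`. The new node is forced to show its pattern on `T * o` for all `o` in
a large sparse set `O`, near markers `s` at unknown positions in a set `R` of size
`const * |O| ^ 2`. For the induction to continue one needs a sparse set `U` that meets `O * s` for
all these `s`; a random sparse set misses a given `O * s` with probability exponentially small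
in `|O|`, so a union bound gives `U` (`exists_spaced_hitting`), and `T * U` takes the place of `T`.

*Freeness.* At the odd levels the marker set is maximal `{1, γ, γ⁻¹}`-spaced, which excludes fixed
points of `γ` (`exists_refinement_smul_ne`).
-/

open scoped Pointwise

/-! ### Spaced sets -/

section Spaced

variable {G : Type u} [Group G] {Z : Type v} [MulAction G Z]

/-- `S` is `D`-spaced if no element of `D` moves a point of `S` to a different point of `S`. -/
def Spaced (D : Set G) (S : Set Z) : Prop :=
  ∀ s ∈ S, ∀ d ∈ D, d • s ∈ S → d • s = s

/-- A `D`-spaced set that meets `D • z` for every `z`. If `D` is symmetric and contains `1`,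
these are the maximal `D`-spaced sets. -/
structure MaxSpaced (D : Set G) (S : Set Z) : Prop where
  spaced : Spaced D S
  exists_smul_mem : ∀ z, ∃ d ∈ D, d • z ∈ S

theorem Spaced.mono {D D' : Set G} {S S' : Set Z} (h : Spaced D S) (hD : D' ⊆ D) (hS : S' ⊆ S) :
    Spaced D' S' :=
  fun s hs d hd hds => h s (hS hs) d (hD hd) (hS hds)

/-- Every Borel `D`-spaced set extends to a Borel maximal one: the space is a countable union of
Borel `D`-spaced sets `C i`, and one adds greedily what is possible from `C 0`, then
from `C 1`, and so on. -/
theorem Spaced.exists_measurableSet_maxSpaced [MeasurableSpace Z] [StandardBorelSpace Z]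
    (hmeas : ∀ g : G, Measurable fun z : Z => g • z) {D : Set G} (hDfin : D.Finite)
    (hDinv : ∀ d ∈ D, d⁻¹ ∈ D) (hD1 : (1 : G) ∈ D) {S₀ : Set Z} (hS₀ : Spaced D S₀)
    (hS₀m : MeasurableSet S₀) :
    ∃ S, S₀ ⊆ S ∧ MeasurableSet S ∧ MaxSpaced D S := by
  classical
  let := upgradeStandardBorel Z
  obtain ⟨b, hbc, -, hb⟩ := TopologicalSpace.exists_countable_basis Z
  obtain ⟨B, hB⟩ : ∃ B : ℕ → Set Z, insert ∅ b = Set.range B :=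
    (hbc.insert ∅).exists_eq_range (Set.insert_nonempty _ _)
  have hBopen : ∀ i, IsOpen (B i) := by
    intro i
    have : B i ∈ insert ∅ b := hB ▸ Set.mem_range_self i
    rcases this with h | h
    · rw [h]; exact isOpen_empty
    · exact hb.isOpen h
  let C : ℕ → Set Z := fun i => {z | z ∈ B i ∧ ∀ d ∈ D, d • z ∈ B i → d • z = z}
  have hCm : ∀ i, MeasurableSet (C i) := by
    intro i
    have : C i = B i ∩ ⋂ d ∈ D, ((fun z => d • z) ⁻¹' (B i)ᶜ ∪ {z | d • z = z}) := by
      ext z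
      simp only [C, Set.mem_ofPred_eq, Set.mem_inter_iff, Set.mem_iInter, Set.mem_union,
        Set.mem_preimage, Set.mem_compl_iff, imp_iff_not_or]
    rw [this]
    refine (hBopen i).measurableSet.inter (MeasurableSet.biInter hDfin.countable fun d _ => ?_)
    exact (hmeas d (hBopen i).measurableSet.compl).union
      (measurableSet_eq_fun (hmeas d) measurable_id)
  have hCcov : ∀ z, ∃ i, z ∈ C i := by
    intro z
    have hfin : ((fun d : G => d • z) '' D \ {z}).Finite := (hDfin.image _).subset Set.sdiff_subset
    have hn : (((fun d : G => d • z) '' D) \ {z})ᶜ ∈ nhds z :=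
      hfin.isClosed.isOpen_compl.mem_nhds (by simp)
    obtain ⟨t, htb, hzt, ht⟩ := hb.mem_nhds_iff.1 hn
    obtain ⟨i, rfl⟩ : t ∈ Set.range B := hB ▸ Set.mem_insert_of_mem _ htb
    refine ⟨i, hzt, fun d hd hdz => ?_⟩
    by_contra hne
    exact ht hdz ⟨⟨d, hd, rfl⟩, hne⟩
  let T : ℕ → Set Z := fun n =>
    Nat.rec S₀ (fun i S => S ∪ {z | z ∈ C i ∧ ∀ d ∈ D, d • z ∉ S}) n
  have hT0 : T 0 = S₀ := rfl
  have hTs : ∀ i, T (i + 1) = T i ∪ {z | z ∈ C i ∧ ∀ d ∈ D, d • z ∉ T i} := fun i => rfl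
  have hTmono : Monotone T := monotone_nat_of_le_succ fun i => by
    rw [hTs]; exact Set.subset_union_left
  have hTm : ∀ i, MeasurableSet (T i) := by
    intro i
    induction i with
    | zero => exact hS₀m
    | succ i ih =>
      rw [hTs]
      refine ih.union ?_
      have : {z | z ∈ C i ∧ ∀ d ∈ D, d • z ∉ T i} =
          C i ∩ ⋂ d ∈ D, (fun z => d • z) ⁻¹' (T i)ᶜ := by
        ext z; simp
      rw [this]
      exact (hCm i).inter (MeasurableSet.biInter hDfin.countable fun d _ => hmeas d ih.compl)
  have hTsp : ∀ i, Spaced D (T i) := by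
    intro i
    induction i with
    | zero => exact hS₀
    | succ i ih =>
      intro s hs d hd hds
      rw [hTs] at hs hds
      rcases hs with hs | hs <;> rcases hds with hds | hds
      · exact ih s hs d hd hds
      · exact absurd (by simpa using hs) (hds.2 d⁻¹ (hDinv d hd))
      · exact absurd hds (hs.2 d hd)
      · exact hs.1.2 d hd hds.1.1
  refine ⟨⋃ i, T i, Set.subset_iUnion T 0, MeasurableSet.iUnion hTm, ?_, ?_⟩
  · intro s hs d hd hds
    obtain ⟨i, hi⟩ := Set.mem_iUnion.1 hs
    obtain ⟨j, hj⟩ := Set.mem_iUnion.1 hds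
    exact hTsp (max i j) s (hTmono (le_max_left _ _) hi) d hd (hTmono (le_max_right _ _) hj)
  · intro z
    obtain ⟨i, hi⟩ := hCcov z
    rcases em (∃ d ∈ D, d • z ∈ T i) with h | h
    · obtain ⟨d, hd, hdz⟩ := h
      exact ⟨d, hd, Set.mem_iUnion.2 ⟨i, hdz⟩⟩
    · push Not at h
      refine ⟨1, hD1, Set.mem_iUnion.2 ⟨i + 1, ?_⟩⟩
      rw [hTs, one_smul]
      exact Or.inr ⟨hi, h⟩

theorem Spaced.exists_maxSpaced [Countable G] {D : Set G} (hDfin : D.Finite)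
    (hDinv : ∀ d ∈ D, d⁻¹ ∈ D) (hD1 : (1 : G) ∈ D) {S₀ : Set G} (hS₀ : Spaced D S₀) :
    ∃ S, S₀ ⊆ S ∧ MaxSpaced D S := by
  let : MeasurableSpace G := ⊤
  have : DiscreteMeasurableSpace G := ⟨fun _ => trivial⟩
  obtain ⟨S, h₁, -, h₂⟩ := hS₀.exists_measurableSet_maxSpaced (fun g => Measurable.of_discrete)
    hDfin hDinv hD1 (MeasurableSet.of_discrete)
  exact ⟨S, h₁, h₂⟩

/-- An infinite group has `D`-spaced subsets of every finite size. -/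
theorem exists_finset_spaced [Infinite G] {D : Set G} (hDfin : D.Finite) (N : ℕ) :
    ∃ O : Finset G, O.card = N ∧ Spaced D (O : Set G) := by
  classical
  induction N with
  | zero => exact ⟨∅, rfl, by simp [Spaced]⟩
  | succ N ih =>
    obtain ⟨O, hO, hOs⟩ := ih
    have hfin : ((O : Set G) ∪ D * O ∪ D⁻¹ * O).Finite :=
      ((O.finite_toSet.union (hDfin.mul O.finite_toSet)).union (hDfin.inv.mul O.finite_toSet))
    obtain ⟨x, hx⟩ := hfin.infinite_compl.nonempty
    simp only [Set.mem_compl_iff, Set.mem_union, not_or] at hx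
    obtain ⟨⟨hx1, hx2⟩, hx3⟩ := hx
    refine ⟨insert x O, by rw [Finset.card_insert_of_notMem (by simpa using hx1), hO], ?_⟩
    intro s hs d hd hds
    simp only [Finset.coe_insert, Set.mem_insert_iff, smul_eq_mul] at hs hds ⊢
    rcases hs with rfl | hs <;> rcases hds with hds | hds
    · exact hds
    · exact absurd ⟨d⁻¹, by simpa using hd, _, hds, by simp⟩ hx3
    · exact absurd ⟨d, hd, s, hs, hds⟩ hx2
    · exact hOs s hs d hd hds

end Spaced

/-! ### Hitting translates of a finite set by a spaced set -/

section Hitting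

open ProbabilityTheory Filter

/-- The fair coin. -/
noncomputable def fairCoin : Measure Bool := (PMF.uniformOfFintype Bool).toMeasure

instance : IsProbabilityMeasure fairCoin := by
  unfold fairCoin; infer_instance

theorem fairCoin_singleton (b : Bool) : fairCoin {b} = 2⁻¹ := by
  simp [fairCoin]

theorem iIndepFun_eval_fairCoin (α : Type u) :
    iIndepFun (fun (a : α) (χ : α → Bool) => χ a) (Measure.infinitePi fun _ : α => fairCoin) :=
  iIndepFun_infinitePi (P := fun _ : α => fairCoin) (X := fun _ b => b) fun _ => measurable_id

/-- Independent fair coin flips follow none of the patterns `π i` prescribed on disjoint blocks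
`B i` of size `d` with probability `(1 - 2⁻ᵈ) ^ (number of blocks)`. -/
theorem measureReal_avoid_patterns {α : Type u} {ι : Type v} (d : ℕ) (B : ι → Finset α)
    (π : ι → α → Bool) (O : Finset ι) (hcard : ∀ i ∈ O, (B i).card = d)
    (hdisj : ∀ i ∈ O, ∀ j ∈ O, i ≠ j → Disjoint (B i) (B j)) :
    (Measure.infinitePi fun _ : α => fairCoin).real {χ | ∀ i ∈ O, ∃ a ∈ B i, χ a ≠ π i a} =
      (1 - (1 / 2 : ℝ) ^ d) ^ O.card := by
  classical
  set μ := Measure.infinitePi fun _ : α => fairCoin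
  have hblock : ∀ i, (B i).card = d → μ.real {χ | ∃ a ∈ B i, χ a ≠ π i a} =
      1 - (1 / 2 : ℝ) ^ d := by
    intro i hi
    have h1 : μ (⋂ a ∈ B i, (fun χ : α → Bool => χ a) ⁻¹' {π i a}) = (2⁻¹ : ENNReal) ^ d := by
      rw [(iIndepFun_eval_fairCoin α).measure_inter_preimage_eq_mul (B i)
        fun a _ => measurableSet_singleton _]
      rw [Finset.prod_congr rfl (g := fun _ => (2⁻¹ : ENNReal)), Finset.prod_const, hi]
      intro a _
      have := (measurePreserving_eval_infinitePi (fun _ : α => fairCoin) a).measure_preimage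
        (measurableSet_singleton (π i a)).nullMeasurableSet
      rw [fairCoin_singleton] at this
      exact this
    have hm : MeasurableSet (⋂ a ∈ B i, (fun χ : α → Bool => χ a) ⁻¹' {π i a}) :=
      Finset.measurableSet_biInter _ fun a _ => measurable_pi_apply a (measurableSet_singleton _)
    have h2 : {χ : α → Bool | ∃ a ∈ B i, χ a ≠ π i a} =
        (⋂ a ∈ B i, (fun χ : α → Bool => χ a) ⁻¹' {π i a})ᶜ := by
      ext χ; simp
    rw [h2, probReal_compl_eq_one_sub hm, measureReal_def, h1]
    simp
  induction O using Finset.induction_on with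
  | empty => simp
  | insert j O hj ih =>
    have hsub : ∀ i ∈ O, i ∈ insert j O := fun i hi => Finset.mem_insert_of_mem hi
    have hD : Disjoint (O.biUnion B) (B j) := by
      rw [Finset.disjoint_biUnion_left]
      exact fun i hi => hdisj i (hsub i hi) j (Finset.mem_insert_self _ _)
        (fun h => hj (h ▸ hi))
    have hind := (iIndepFun_eval_fairCoin α).indepFun_finset _ _ hD
      fun a => measurable_pi_apply a
    let A₁ : Set (O.biUnion B → Bool) := {ψ | ∀ i, ∀ hi : i ∈ O, ∃ a, ∃ ha : a ∈ B i,
      ψ ⟨a, Finset.mem_biUnion.2 ⟨i, hi, ha⟩⟩ ≠ π i a}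
    let A₂ : Set (B j → Bool) := {ψ | ∃ a, ∃ ha : a ∈ B j, ψ ⟨a, ha⟩ ≠ π j a}
    have h := hind.measure_inter_preimage_eq_mul A₁ A₂ (Set.toFinite _).measurableSet
      (Set.toFinite _).measurableSet
    have e1 : (fun (χ : α → Bool) (i : O.biUnion B) => χ i) ⁻¹' A₁ =
        {χ | ∀ i ∈ O, ∃ a ∈ B i, χ a ≠ π i a} := by
      ext χ; simp [A₁]
    have e2 : (fun (χ : α → Bool) (i : B j) => χ i) ⁻¹' A₂ = {χ | ∃ a ∈ B j, χ a ≠ π j a} := by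
      ext χ; simp [A₂]
    rw [e1, e2] at h
    have e3 : {χ : α → Bool | ∀ i ∈ insert j O, ∃ a ∈ B i, χ a ≠ π i a} =
        {χ | ∀ i ∈ O, ∃ a ∈ B i, χ a ≠ π i a} ∩ {χ | ∃ a ∈ B j, χ a ≠ π j a} := by
      ext χ; simp [and_comm]
    rw [e3, measureReal_def, h, ENNReal.toReal_mul, ← measureReal_def, ← measureReal_def,
      ih (fun i hi => hcard i (hsub i hi)) (fun i hi k hk => hdisj i (hsub i hi) k (hsub k hk)),
      hblock j (hcard j (Finset.mem_insert_self _ _)), Finset.card_insert_of_notMem hj, pow_succ]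

variable {G : Type u} [Group G]

/-- There are arbitrarily sparse finite sets `O` such that, for every `R` of size at most
`c * |O| ^ 2`, some `D`-spaced set `U` meets all the translates `O * s` with `s ∈ R`. -/
theorem exists_spaced_hitting [Infinite G] {C D : Set G} (hC : C.Finite) (hD : D.Finite)
    (c : ℕ) :
    ∃ O : Finset G, O.Nonempty ∧ Spaced C (O : Set G) ∧
      ∀ R : Finset G, R.card ≤ c * O.card ^ 2 →
        ∃ U : Set G, U.Finite ∧ Spaced D U ∧ ∀ s ∈ R, ∃ o ∈ O, o * s ∈ U := by
  classical
  -- `D'` is a symmetric finite set that contains `D` and `1`.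
  obtain ⟨D', hDD', hD'1, hD'inv⟩ : ∃ D' : Finset G, D ⊆ D' ∧ 1 ∈ D' ∧ ∀ d ∈ D', d⁻¹ ∈ D' := by
    refine ⟨((hD.union hD.inv).insert 1).toFinset, ?_, by simp, ?_⟩
    · intro d hd; simp [hd]
    · intro d hd
      simp only [Set.Finite.mem_toFinset, Set.mem_insert_iff, Set.mem_union, Set.mem_inv, inv_inv,
        inv_eq_one] at hd ⊢
      tauto
  set d := D'.card
  set r : ℝ := 1 - (1 / 2 : ℝ) ^ d
  have hr0 : 0 ≤ r := by
    have : (1 / 2 : ℝ) ^ d ≤ 1 := pow_le_one₀ (by norm_num) (by norm_num)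
    simp only [r]; linarith
  have hr1 : r < 1 := by
    have : 0 < (1 / 2 : ℝ) ^ d := by positivity
    simp only [r]; linarith
  obtain ⟨N, hN, hN0⟩ : ∃ N : ℕ, (c : ℝ) * ((N : ℝ) ^ 2 * r ^ N) < 1 ∧ 1 ≤ N := by
    have h := (tendsto_pow_const_mul_const_pow_of_abs_lt_one 2
      (abs_lt.2 ⟨by linarith, hr1⟩)).const_mul (c : ℝ)
    rw [mul_zero] at h
    exact ((h.eventually (gt_mem_nhds one_pos)).and (eventually_ge_atTop 1)).exists
  obtain ⟨O, hON, hO⟩ := exists_finset_spaced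
    (hC.union (D'.finite_toSet.mul D'.finite_toSet)) N
  refine ⟨O, Finset.card_pos.1 (by omega), hO.mono Set.subset_union_left subset_rfl, ?_⟩
  intro R hR
  set μ := Measure.infinitePi fun _ : G => fairCoin
  -- A point `g` with `χ g` and `¬ χ h` for all other `h ∈ D' * g` can be put into `U`.
  let bad : G → Set (G → Bool) := fun s =>
    {χ | ∀ o ∈ O, ∃ a ∈ D'.image (· * (o * s)), χ a ≠ decide (a = o * s)}
  have hbad : ∀ s, μ.real (bad s) = r ^ N := by
    intro s
    rw [← hON]
    refine measureReal_avoid_patterns d (fun o => D'.image (· * (o * s)))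
      (fun o a => decide (a = o * s)) O ?_ ?_
    · intro o _
      exact Finset.card_image_of_injective _ (mul_left_injective _)
    · intro o ho o' ho' hne
      rw [Finset.disjoint_left]
      intro a ha ha'
      obtain ⟨x, hx, rfl⟩ := Finset.mem_image.1 ha
      obtain ⟨y, hy, hxy⟩ := Finset.mem_image.1 ha'
      have e : (y⁻¹ * x) * o = o' := by
        have : y * o' = x * o := by
          simpa only [← mul_assoc, mul_left_inj] using hxy
        rw [mul_assoc, ← this]; simp
      have := hO o ho (y⁻¹ * x) (Or.inr ⟨y⁻¹, hD'inv y hy, x, hx, rfl⟩)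
        (by rw [smul_eq_mul, e]; exact ho')
      rw [smul_eq_mul, e] at this
      exact hne this.symm
  obtain ⟨χ, hχ⟩ : ∃ χ, χ ∉ ⋃ s ∈ R, bad s := by
    by_contra! hall
    have hU : (⋃ s ∈ R, bad s) = Set.univ := Set.eq_univ_of_forall hall
    have h1 : μ.real (⋃ s ∈ R, bad s) ≤ ∑ s ∈ R, μ.real (bad s) :=
      measureReal_biUnion_finset_le _ _
    rw [hU, probReal_univ, Finset.sum_congr rfl (fun s _ => hbad s), Finset.sum_const,
      nsmul_eq_mul] at h1
    have h2 : (R.card : ℝ) ≤ c * (N : ℝ) ^ 2 := by rw [← hON]; exact_mod_cast hR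
    have := mul_le_mul_of_nonneg_right h2 (pow_nonneg hr0 N)
    nlinarith
  refine ⟨{g | g ∈ O * R ∧ χ g = true ∧ ∀ x ∈ D', x * g ≠ g → χ (x * g) = false}, ?_, ?_, ?_⟩
  · exact (O * R).finite_toSet.subset fun g hg => hg.1
  · rintro g ⟨-, -, hg⟩ x hx ⟨-, hxg, -⟩
    by_contra hne
    have := hg x (hDD' hx) hne
    rw [smul_eq_mul] at hxg
    simp [hxg] at this
  · intro s hs
    simp only [bad, Set.mem_iUnion, Set.mem_ofPred_eq, not_exists, not_forall, not_and,
      not_not] at hχ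
    obtain ⟨o, ho, h⟩ := hχ s hs
    refine ⟨o, ho, Finset.mul_mem_mul ho hs, ?_, ?_⟩
    · rw [h _ (Finset.mem_image.2 ⟨1, hD'1, one_mul _⟩)]; simp
    · intro x hx hne
      rw [h _ (Finset.mem_image.2 ⟨x, hx, rfl⟩)]; simpa using hne

end Hitting

/-! ### Configurations and stages -/

/-- Configurations on `G`. At every `g : G` there are countably many tracks, each carrying a
data bit (first component) and a marker bit (second component). -/
def Config (G : Type u) : Type u := G → ℕ → Bool × Bool

namespace Config

variable {G : Type u}

instance : TopologicalSpace (Config G) :=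
  inferInstanceAs (TopologicalSpace (G → ℕ → Bool × Bool))

instance : CompactSpace (Config G) := inferInstanceAs (CompactSpace (G → ℕ → Bool × Bool))

instance : T2Space (Config G) := inferInstanceAs (T2Space (G → ℕ → Bool × Bool))

instance : MeasurableSpace (Config G) :=
  inferInstanceAs (MeasurableSpace (G → ℕ → Bool × Bool))

instance [Group G] : MulAction G (Config G) where
  smul h x := fun g => x (g * h)
  one_smul x := funext fun g => congrArg x (mul_one g)
  mul_smul h k x := funext fun g => congrArg x (mul_assoc g h k).symm

theorem smul_apply [Group G] (h : G) (x : Config G) (g : G) : (h • x) g = x (g * h) := rfl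

/-- The set of positions at which track `n` carries a marker. -/
def mark (x : Config G) (n : ℕ) : Set G := {g | (x g n).2 = true}

end Config

section Stage

variable {G : Type u} [Group G] {Z : Type v} [MulAction G Z]

/-- The configuration of the labels seen along the orbit of `z`. For `Z = G`, with `G` acting on
itself by left multiplication, this is the configuration `z • ℓ`. -/
def orbitMap (ℓ : Z → ℕ → Bool × Bool) (z : Z) : Config G := fun g => ℓ (g • z)

theorem smul_orbitMap (ℓ : Z → ℕ → Bool × Bool) (z : Z) (g : G) :
    g • (orbitMap ℓ z : Config G) = orbitMap ℓ (g • z) := by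
  funext h
  simp [Config.smul_apply, orbitMap, mul_smul]

/-- `X` is a non-empty invariant set of configurations that only constrains the first `n` tracks,
is defined by local rules with window `V` (a subshift of finite type), and in which any finite
piece of a configuration can be written over any other configuration by changing the latter
within the margin `E` only. -/
structure IsStage (n : ℕ) (V E : Set G) (X : Set (Config G)) : Prop where
  finite_window : V.Finite
  one_mem_window : 1 ∈ V
  finite_margin : E.Finite
  one_mem_margin : 1 ∈ E
  nonempty : X.Nonempty
  smul_mem : ∀ x ∈ X, ∀ g : G, g • x ∈ X
  mem_of_local : ∀ z : Config G,
    (∀ g, ∃ x ∈ X, ∀ v ∈ V, ∀ k < n, z (v * g) k = x (v * g) k) → z ∈ X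
  exists_patch : ∀ F : Set G, F.Finite → ∀ x ∈ X, ∀ p ∈ X, ∃ x' ∈ X,
    (∀ f ∈ F, ∀ k < n, x' f k = p f k) ∧ ∀ g k, g ∉ E * F ∨ n ≤ k → x' g k = x g k

theorem IsStage.mem_of_eq {n : ℕ} {V E : Set G} {X : Set (Config G)} (hX : IsStage n V E X)
    {x z : Config G} (hx : x ∈ X) (h : ∀ g, ∀ k < n, z g k = x g k) : z ∈ X :=
  hX.mem_of_local z fun _ => ⟨x, hx, fun _ _ k hk => h _ k hk⟩

theorem isStage_univ : IsStage 0 {1} {1} (Set.univ : Set (Config G)) where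
  finite_window := Set.finite_singleton 1
  one_mem_window := rfl
  finite_margin := Set.finite_singleton 1
  one_mem_margin := rfl
  nonempty := ⟨fun _ _ => (false, false), trivial⟩
  smul_mem _ _ _ := trivial
  mem_of_local _ _ := trivial
  exists_patch _ _ x _ _ _ := ⟨x, trivial, by simp, by simp⟩

/-! ### Writing at many places at once -/

/-- The elements `a` for which the sets `Q * s` and `Q * (a * s)` can meet a common translate of
the window `V`. -/
def conflictSet (V Q : Set G) : Set G := Q⁻¹ * V * V⁻¹ * Q

theorem conflictSet_finite {V Q : Set G} (hV : V.Finite) (hQ : Q.Finite) :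
    (conflictSet V Q).Finite :=
  ((hQ.inv.mul hV).mul hV.inv).mul hQ

theorem mem_conflictSet {V Q : Set G} {q q' v v' : G} (hq : q ∈ Q) (hq' : q' ∈ Q) (hv : v ∈ V)
    (hv' : v' ∈ V) : q'⁻¹ * v' * v⁻¹ * q ∈ conflictSet V Q :=
  Set.mul_mem_mul (Set.mul_mem_mul (Set.mul_mem_mul (Set.inv_mem_inv.2 hq') hv')
    (Set.inv_mem_inv.2 hv)) hq

theorem mem_conflictSet' {V Q : Set G} {q q' : G} (hq : q ∈ Q) (hq' : q' ∈ Q) (hV : 1 ∈ V) :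
    q'⁻¹ * q ∈ conflictSet V Q := by
  simpa using mem_conflictSet hq hq' hV hV

theorem inv_mem_conflictSet {V Q : Set G} {a : G} (ha : a ∈ conflictSet V Q) :
    a⁻¹ ∈ conflictSet V Q := by
  obtain ⟨_, ⟨_, ⟨q', hq', v', hv', rfl⟩, v, hv, rfl⟩, q, hq, rfl⟩ := ha
  have := mem_conflictSet (Set.mem_inv.1 hq') hq hv' (Set.mem_inv.1 hv)
  simpa [mul_assoc] using this

open Classical in
/-- Overwrites the label `ℓ` by the pattern `y s` on `Q • s`, for every `s ∈ S`. Where several of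
these sets overlap an arbitrary one is chosen; `glue` is only used when they are disjoint. -/
noncomputable def glue (Q : Set G) (S : Set Z) (y : Z → Config G) (ℓ : Z → ℕ → Bool × Bool)
    (z : Z) : ℕ → Bool × Bool :=
  if h : ∃ q ∈ Q, q⁻¹ • z ∈ S then y (h.choose⁻¹ • z) h.choose else ℓ z

theorem glue_of_notMem {Q : Set G} {S : Set Z} (y : Z → Config G) (ℓ : Z → ℕ → Bool × Bool) {z : Z}
    (hz : ∀ q ∈ Q, q⁻¹ • z ∉ S) : glue Q S y ℓ z = ℓ z :=
  dif_neg (by push Not; exact hz)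

theorem glue_smul (hfree : ∀ (z : Z) (g : G), g • z = z → g = 1) {V Q : Set G} (hV : 1 ∈ V)
    {S : Set Z} (hS : Spaced (conflictSet V Q) S) (y : Z → Config G) (ℓ : Z → ℕ → Bool × Bool)
    {s : Z} (hs : s ∈ S) {q : G} (hq : q ∈ Q) : glue Q S y ℓ (q • s) = y s q := by
  have h : ∃ q' ∈ Q, q'⁻¹ • q • s ∈ S := ⟨q, hq, by simpa using hs⟩
  rw [glue, dif_pos h]
  obtain ⟨h1, h2⟩ := h.choose_spec
  have h3 := hfree _ _ (hS s hs _ (mem_conflictSet' hq h1 hV) (by rwa [mul_smul]))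
  have h4 : h.choose = q := (inv_mul_eq_one.1 h3)
  rw [h4, inv_smul_smul]

/-- Overwriting at places that are far apart does not lead out of a stage if it does not at any
single place, since a window meets at most one of the changed regions. -/
theorem orbitMap_glue_mem (hfree : ∀ (z : Z) (g : G), g • z = z → g = 1) {n : ℕ} {V E Q : Set G}
    {X : Set (Config G)} (hX : IsStage n V E X) {S : Set Z} (hS : Spaced (conflictSet V Q) S)
    {y : Z → Config G} {ℓ : Z → ℕ → Bool × Bool} (hℓ : ∀ z, orbitMap ℓ z ∈ X)
    (hy : ∀ s ∈ S, y s ∈ X) (hyℓ : ∀ s ∈ S, ∀ g ∉ Q, y s g = ℓ (g • s)) (z : Z) :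
    orbitMap (glue Q S y ℓ) z ∈ X := by
  refine hX.mem_of_local _ fun h => ?_
  by_cases hh : ∃ v ∈ V, ∃ q ∈ Q, q⁻¹ • (v * h) • z ∈ S
  · -- The window around `h` meets exactly one of the sets `Q • s`.
    obtain ⟨v, hv, q, hq, hs⟩ := hh
    set s := q⁻¹ • (v * h) • z with hsdef
    have hz : z = (h⁻¹ * v⁻¹ * q) • s := by
      rw [hsdef]; simp [← mul_smul, mul_assoc]
    refine ⟨(h⁻¹ * v⁻¹ * q) • y s, hX.smul_mem _ (hy s hs) _, fun v' hv' k _ => ?_⟩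
    have e : (v' * h) • z = (v' * h * (h⁻¹ * v⁻¹ * q)) • s := by
      conv_lhs => rw [hz]
      rw [← mul_smul]
    rw [Config.smul_apply, orbitMap, e]
    set a := v' * h * (h⁻¹ * v⁻¹ * q) with ha
    have ha' : a = v' * v⁻¹ * q := by simp [ha, mul_assoc]
    by_cases haQ : a ∈ Q
    · rw [glue_smul hfree hX.one_mem_window hS y ℓ hs haQ]
    · rw [hyℓ s hs a haQ, glue_of_notMem]
      intro q' hq' hs'
      refine haQ ?_
      have hm : q'⁻¹ * a ∈ conflictSet V Q := by
        rw [ha', ← mul_assoc, ← mul_assoc]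
        exact mem_conflictSet hq hq' hv hv'
      rw [← mul_smul] at hs'
      have := hfree _ _ (hS s hs _ hm hs')
      rwa [← inv_mul_eq_one.1 this]
  · push Not at hh
    refine ⟨orbitMap ℓ z, hℓ z, fun v hv k _ => ?_⟩
    simp only [orbitMap]
    rw [glue_of_notMem y ℓ (hh v hv)]

/-- Patching at every place of `S ⊆ Z` at once. -/
theorem IsStage.exists_glue (hfree : ∀ (z : Z) (g : G), g • z = z → g = 1) {n : ℕ} {V E : Set G}
    {X : Set (Config G)} (hX : IsStage n V E X) {F : Set G} (hF : F.Finite) {S : Set Z}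
    (hS : Spaced (conflictSet V (E * F)) S) {p : Z → Config G} (hp : ∀ s, p s ∈ X)
    {ℓ : Z → ℕ → Bool × Bool} (hℓ : ∀ z, orbitMap ℓ z ∈ X) :
    ∃ ℓ' : Z → ℕ → Bool × Bool, (∀ z, orbitMap ℓ' z ∈ X) ∧
      (∀ s ∈ S, ∀ f ∈ F, ∀ k < n, ℓ' (f • s) k = p s f k) ∧
      (∀ s ∈ S, ∀ q ∈ E * F, ∀ k, n ≤ k → ℓ' (q • s) k = ℓ (q • s) k) ∧
      ∀ z, (∀ q ∈ E * F, q⁻¹ • z ∉ S) → ℓ' z = ℓ z := by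
  choose y hyX hyF hyE using fun s => hX.exists_patch F hF _ (hℓ s) _ (hp s)
  refine ⟨glue (E * F) S y ℓ, orbitMap_glue_mem hfree hX hS hℓ (fun s _ => hyX s)
    (fun s _ g hg => funext fun k => hyE s g k (Or.inl hg)), ?_, ?_,
    fun z => glue_of_notMem y ℓ⟩
  · intro s hs f hf k hk
    rw [glue_smul hfree hX.one_mem_window hS y ℓ hs (q := f)
      ⟨1, hX.one_mem_margin, f, hf, one_mul f⟩, hyF s f hf k hk]
  · intro s hs q hq k hk
    rw [glue_smul hfree hX.one_mem_window hS y ℓ hs hq, hyE s q k (Or.inr hk)]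
    rfl

/-! ### Forcing a pattern -/

/-- The configurations in `X` whose markers on track `n` form a maximal `D`-spaced set, and that
show the pattern `p` on `F * s` for every marker `s`. -/
def stepSet (n : ℕ) (X : Set (Config G)) (D F : Set G) (p : Config G) : Set (Config G) :=
  {x | x ∈ X ∧ MaxSpaced D (x.mark n) ∧ ∀ s ∈ x.mark n, ∀ f ∈ F, ∀ k < n, x (f * s) k = p f k}

theorem MaxSpaced.preimage_smul (hfree : ∀ (z : Z) (g : G), g • z = z → g = 1) {D : Set G}
    {S : Set Z} (hS : MaxSpaced D S) (z : Z) : MaxSpaced D {g : G | g • z ∈ S} where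
  spaced g hg d hd hdg := by
    have := hfree _ _ (hS.spaced _ hg d hd (by rw [← mul_smul]; exact hdg))
    rw [this, one_smul]
  exists_smul_mem g := by
    obtain ⟨d, hd, h⟩ := hS.exists_smul_mem (g • z)
    exact ⟨d, hd, by rw [smul_eq_mul, Set.mem_ofPred_eq, mul_smul]; exact h⟩

open Classical in
/-- Sets the markers of track `n` to `S` and writes the patterns `y s` on `Q • s`. -/
noncomputable def stepLabel (n : ℕ) (Q : Set G) (S : Set Z) (y : Z → Config G)
    (ℓ : Z → ℕ → Bool × Bool) (z : Z) (k : ℕ) : Bool × Bool :=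
  if k = n then ((ℓ z n).1, decide (z ∈ S)) else glue Q S y ℓ z k

/-- A labelling in `X` yields one in `stepSet n X D F p`, given any maximal `D`-spaced set in the
space and, for each of its points, a way to write `p` there. -/
theorem orbitMap_stepLabel_mem (hfree : ∀ (z : Z) (g : G), g • z = z → g = 1) {n : ℕ}
    {V E D F : Set G} {X : Set (Config G)} (hX : IsStage n V E X) {S : Set Z}
    (hD : conflictSet V (E * F) ⊆ D) (hS : MaxSpaced D S) {p : Config G}
    {y : Z → Config G} {ℓ : Z → ℕ → Bool × Bool} (hℓ : ∀ z, orbitMap ℓ z ∈ X)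
    (hy : ∀ s ∈ S, y s ∈ X) (hyp : ∀ s ∈ S, ∀ f ∈ F, ∀ k < n, y s f k = p f k)
    (hyℓ : ∀ s ∈ S, ∀ g ∉ E * F, y s g = ℓ (g • s)) (z : Z) :
    orbitMap (stepLabel n (E * F) S y ℓ) z ∈ stepSet n X D F p := by
  have hS' := hS.spaced.mono hD subset_rfl
  have hmark : (orbitMap (stepLabel n (E * F) S y ℓ) z : Config G).mark n =
      {g : G | g • z ∈ S} := by
    ext g; simp [Config.mark, orbitMap, stepLabel]
  refine ⟨hX.mem_of_eq (orbitMap_glue_mem hfree hX hS' hℓ hy hyℓ z) fun g k hk => ?_, ?_, ?_⟩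
  · simp [orbitMap, stepLabel, hk.ne]
  · rw [hmark]; exact hS.preimage_smul hfree z
  · rw [hmark]
    intro g hg f hf k hk
    have hfQ : f ∈ E * F := ⟨1, hX.one_mem_margin, f, hf, one_mul f⟩
    simp only [orbitMap, stepLabel, hk.ne, if_false, mul_smul]
    rw [glue_smul hfree hX.one_mem_window hS' y ℓ hg hfQ]
    exact hyp _ hg f hf k hk

theorem smul_self_eq_imp (z g : G) (h : g • z = z) : g = 1 := by simpa using h

theorem orbitMap_one (x : G → ℕ → Bool × Bool) : (orbitMap x (1 : G) : Config G) = x :=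
  funext fun g => congrArg x (mul_one g)

theorem IsStage.orbitMap_mem {n : ℕ} {V E : Set G} {X : Set (Config G)} (hX : IsStage n V E X)
    {x : Config G} (hx : x ∈ X) (g : G) : orbitMap x g ∈ X :=
  hX.smul_mem x hx g

variable [Countable G]

/-- The patching property of `stepSet`. The markers of the old configuration far from `F'` and
those of `p'` near `F'` form a spaced set; the finitely many markers needed to make it maximal are
so far from `F'` that the pattern `p` can be written at them. -/
theorem IsStage.exists_patch_stepSet {n : ℕ} {V E D F : Set G} {X : Set (Config G)}
    (hX : IsStage n V E X) (hF : F.Finite) {p : Config G} (hp : p ∈ X)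
    (hDfin : D.Finite) (hDinv : ∀ d ∈ D, d⁻¹ ∈ D) (hD1 : 1 ∈ D)
    (hD : conflictSet V (E * F) ⊆ D) :
    ∃ E' : Set G, E'.Finite ∧ 1 ∈ E' ∧ ∀ F' : Set G, F'.Finite → ∀ x ∈ stepSet n X D F p,
      ∀ p' ∈ stepSet n X D F p, ∃ x' ∈ stepSet n X D F p,
        (∀ f ∈ F', ∀ k < n + 1, x' f k = p' f k) ∧
        ∀ g k, g ∉ E' * F' ∨ n + 1 ≤ k → x' g k = x g k := by
  classical
  set Q := E * F with hQ
  have hQfin : Q.Finite := hX.finite_margin.mul hF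
  have hFQ : F ⊆ Q := fun f hf => ⟨1, hX.one_mem_margin, f, hf, one_mul f⟩
  -- All the regions below are of the form `A * F'` with `A` finite and independent of `F'`.
  let A : Set G := D * ({1} ∪ Q⁻¹)
  let A₂ : Set G := {1} ∪ F * A
  let B : Set G := D * A ∪ F⁻¹ * (E * A₂)
  have hAfin : A.Finite := hDfin.mul ((Set.finite_singleton 1).union hQfin.inv)
  have hA₂fin : A₂.Finite := (Set.finite_singleton 1).union (hF.mul hAfin)
  have hBfin : B.Finite := (hDfin.mul hAfin).union (hF.inv.mul (hX.finite_margin.mul hA₂fin))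
  refine ⟨E * A₂ ∪ Q * (D * B) ∪ D * B ∪ {1}, ?_, Or.inr rfl, ?_⟩
  · exact (((hX.finite_margin.mul hA₂fin).union (hQfin.mul (hDfin.mul hBfin))).union
      (hDfin.mul hBfin)).union (Set.finite_singleton 1)
  rintro F' hF' x ⟨hxX, hxS, hxF⟩ p' ⟨hpX, hpS, hpF⟩
  set S := x.mark n with hSdef
  set T := p'.mark n with hTdef
  let H : Set G := A * F'
  let F₂ : Set G := A₂ * F'
  let H' : Set G := B * F'
  let T₀ : Set G := T ∩ H
  let S₀ : Set G := S \ H'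
  have hF'H : F' ⊆ H := fun f hf => ⟨1, ⟨1, hD1, 1, Or.inl rfl, one_mul 1⟩, f, hf, one_mul f⟩
  have hF'F₂ : F' ⊆ F₂ := fun f hf => ⟨1, Or.inl rfl, f, hf, one_mul f⟩
  have hFHF₂ : F * H ⊆ F₂ := by
    rw [← mul_assoc]; exact Set.mul_subset_mul_right Set.subset_union_right
  have hDHH' : D * H ⊆ H' := by
    rw [← mul_assoc]; exact Set.mul_subset_mul_right Set.subset_union_left
  have hFEH' : F⁻¹ * (E * F₂) ⊆ H' := by
    have : F⁻¹ * (E * F₂) = F⁻¹ * (E * A₂) * F' := by simp only [F₂, mul_assoc]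
    rw [this]; exact Set.mul_subset_mul_right Set.subset_union_right
  have hHH' : H ⊆ H' := fun h hh => hDHH' ⟨1, hD1, h, hh, one_mul h⟩
  -- The markers that are kept.
  have hsp : Spaced D (S₀ ∪ T₀) := by
    rintro s hs d hd hds
    rcases hs with hs | hs <;> rcases hds with hds | hds
    · exact hxS.spaced s hs.1 d hd hds.1
    · exact absurd (hDHH' ⟨d⁻¹, hDinv d hd, _, hds.2, by simp⟩) hs.2
    · exact absurd (hDHH' ⟨d, hd, s, hs.2, rfl⟩) hds.2
    · exact hpS.spaced s hs.1 d hd hds.1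
  obtain ⟨S', hS'sub, hS'⟩ := hsp.exists_maxSpaced hDfin hDinv hD1
  let U : Set G := S' \ (S₀ ∪ T₀)
  have hsame : ∀ {s t : G}, s ∈ S' → t ∈ S' → t * s⁻¹ ∈ D → t = s := by
    intro s t hs ht h
    have := hS'.spaced s hs _ h (by simpa using ht)
    simpa using this
  have hUH' : ∀ u ∈ U, u ∈ D * H' := by
    rintro u ⟨huS', hu⟩
    by_cases huS : u ∈ S
    · refine ⟨1, hD1, u, ?_, one_mul u⟩
      by_contra huH'
      exact hu (Or.inl ⟨huS, huH'⟩)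
    · obtain ⟨d, hd, hdu⟩ := hxS.exists_smul_mem u
      by_cases hH' : d • u ∈ H'
      · exact ⟨d⁻¹, hDinv d hd, d • u, hH', by simp⟩
      · have := hS'.spaced u huS' d hd (hS'sub (Or.inl ⟨hdu, hH'⟩))
        rw [this] at hdu
        exact absurd hdu huS
  have hUF' : ∀ u ∈ U, u ∉ ({1} ∪ Q⁻¹) * F' := by
    rintro u ⟨huS', hu⟩ huF
    obtain ⟨d, hd, hdu⟩ := hpS.exists_smul_mem u
    have hH : d • u ∈ H := by
      simp only [H, A, mul_assoc]
      exact ⟨d, hd, u, huF, rfl⟩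
    have hT₀ : d • u ∈ T₀ := ⟨hdu, hH⟩
    have := hS'.spaced u huS' d hd (hS'sub (Or.inr hT₀))
    rw [this] at hT₀
    exact hu (Or.inr hT₀)
  have hS'F' : ∀ f ∈ F', (f ∈ S' ↔ f ∈ T) := by
    intro f hf
    refine ⟨fun h => ?_, fun h => hS'sub (Or.inr ⟨h, hF'H hf⟩)⟩
    by_cases hfU : f ∈ U
    · exact absurd ⟨1, Or.inl rfl, f, hf, one_mul f⟩ (hUF' f hfU)
    · have : f ∈ S₀ ∪ T₀ := by
        by_contra h'; exact hfU ⟨h, h'⟩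
      rcases this with h' | h'
      · exact absurd (hHH' (hF'H hf)) h'.2
      · exact h'.1
  have hS'S : ∀ g ∉ D * H', (g ∈ S' ↔ g ∈ S) := by
    intro g hg
    have hgH' : g ∉ H' := fun h => hg ⟨1, hD1, g, h, one_mul g⟩
    refine ⟨fun h => ?_, fun h => hS'sub (Or.inl ⟨h, hgH'⟩)⟩
    by_cases hfU : g ∈ U
    · exact absurd (hUH' g hfU) hg
    · have : g ∈ S₀ ∪ T₀ := by
        by_contra h'; exact hfU ⟨h, h'⟩
      rcases this with h' | h'
      · exact h'.1
      · exact absurd (hHH' h'.2) hgH'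
  have hF₂fin : F₂.Finite := hA₂fin.mul hF'
  -- Write `p'` on `F₂`, and then `p` at the new markers.
  obtain ⟨x₁, hx₁X, hx₁p, hx₁x⟩ := hX.exists_patch F₂ hF₂fin x hxX p' hpX
  obtain ⟨x₂, hx₂X, hx₂p, hx₂Q, hx₂x⟩ := hX.exists_glue (Z := G) smul_self_eq_imp hF
    (S := U) (hS'.spaced.mono hD Set.sdiff_subset) (p := fun _ => p) (fun _ => hp)
    (ℓ := x₁) (hX.orbitMap_mem hx₁X)
  have hx₂X : (x₂ : Config G) ∈ X := by
    have := hx₂X 1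
    rwa [orbitMap_one] at this
  have hx₂k : ∀ g k, n ≤ k → x₂ g k = x g k := by
    intro g k hk
    rw [← hx₁x g k (Or.inr hk)]
    by_cases h : ∃ q ∈ Q, q⁻¹ • g ∈ U
    · obtain ⟨q, hq, hu⟩ := h
      have := hx₂Q _ hu q hq k hk
      simpa using this
    · push Not at h
      rw [hx₂x g h]
  have hx₂far : ∀ s ∈ S₀ ∪ T₀, ∀ f ∈ F, x₂ (f * s) = x₁ (f * s) := by
    intro s hs f hf
    refine hx₂x _ fun q hq hu => hu.2 ?_
    have hm : q⁻¹ • (f * s) * s⁻¹ ∈ D :=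
      hD (by simpa [mul_assoc] using mem_conflictSet' (hFQ hf) hq hX.one_mem_window)
    rwa [hsame (hS'sub hs) hu.1 hm]
  let x' : Config G := fun g k =>
    if k = n then ((if g ∈ F' then p' g n else x g n).1, decide (g ∈ S')) else x₂ g k
  have hmark : x'.mark n = S' := by
    ext g; simp [Config.mark, x']
  have hx'k : ∀ g k, k ≠ n → x' g k = x₂ g k := fun g k hk => by simp [x', hk]
  refine ⟨x', ⟨hX.mem_of_eq hx₂X fun g k hk => hx'k g k hk.ne, by rwa [hmark], ?_⟩, ?_, ?_⟩
  · rw [hmark]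
    intro s hs f hf k hk
    rw [hx'k _ _ hk.ne]
    by_cases hsU : s ∈ U
    · exact hx₂p s hsU f hf k hk
    · have hs0 : s ∈ S₀ ∪ T₀ := by
        by_contra h'; exact hsU ⟨hs, h'⟩
      rw [hx₂far s hs0 f hf]
      rcases hs0 with hs0 | hs0
      · rw [hx₁x _ _ (Or.inl _)]
        · exact hxF s hs0.1 f hf k hk
        · intro h
          exact hs0.2 (hFEH' ⟨f⁻¹, Set.inv_mem_inv.2 hf, f * s, h, by simp⟩)
      · rw [hx₁p _ (hFHF₂ ⟨f, hf, s, hs0.2, rfl⟩) k hk]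
        exact hpF s hs0.1 f hf k hk
  · intro f hf k hk
    by_cases hkn : k = n
    · subst hkn
      have h := hS'F' f hf
      rw [hTdef, Config.mark, Set.mem_ofPred_eq] at h
      simp only [x', if_true, if_pos hf]
      ext
      · rfl
      · simp only [h]; simp
    · rw [hx'k _ _ hkn, hx₂x f, hx₁p f (hF'F₂ hf) k (by omega)]
      intro q hq hu
      exact hUF' _ hu ⟨q⁻¹, Or.inr (Set.inv_mem_inv.2 hq), f, hf, rfl⟩
  · intro g k hgk
    have hE' : (E * A₂ ∪ Q * (D * B) ∪ D * B ∪ {1}) * F' =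
        E * F₂ ∪ Q * (D * H') ∪ D * H' ∪ F' := by
      simp only [Set.union_mul, mul_assoc, F₂, H', Set.singleton_one, one_mul]
    rw [hE'] at hgk
    by_cases hkn : k = n
    · subst hkn
      have hg : g ∉ E * F₂ ∪ Q * (D * H') ∪ D * H' ∪ F' := hgk.resolve_right (by omega)
      simp only [Set.mem_union, not_or] at hg
      have h := hS'S g hg.1.2
      rw [hSdef, Config.mark, Set.mem_ofPred_eq] at h
      simp only [x', if_true, if_neg hg.2]
      ext
      · rfl
      · simp only [h]; simp
    · rw [hx'k _ _ hkn]
      rcases hgk with hg | hk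
      · simp only [Set.mem_union, not_or] at hg
        rw [hx₂x g, hx₁x g k (Or.inl hg.1.1.1)]
        intro q hq hu
        exact hg.1.1.2 ⟨q, hq, _, hUH' _ hu, by simp⟩
      · exact hx₂k g k (by omega)

theorem IsStage.exists_isStage_stepSet {n : ℕ} {V E D F : Set G} {X : Set (Config G)}
    (hX : IsStage n V E X) (hF : F.Finite) {p : Config G} (hp : p ∈ X)
    (hDfin : D.Finite) (hDinv : ∀ d ∈ D, d⁻¹ ∈ D) (hD1 : 1 ∈ D)
    (hD : conflictSet V (E * F) ⊆ D) :
    ∃ V' E' : Set G, IsStage (n + 1) V' E' (stepSet n X D F p) := by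
  obtain ⟨E', hE'fin, hE'1, hE'⟩ := hX.exists_patch_stepSet hF hp hDfin hDinv hD1 hD
  refine ⟨V ∪ D ∪ F, E', ?_⟩
  constructor
  · exact (hX.finite_window.union hDfin).union hF
  · exact Or.inl (Or.inl hX.one_mem_window)
  · exact hE'fin
  · exact hE'1
  · obtain ⟨S, -, hS⟩ := Spaced.exists_maxSpaced hDfin hDinv hD1 (S₀ := (∅ : Set G))
      (by simp [Spaced])
    choose y hyX hyF hyE using fun s => hX.exists_patch F hF _ (hX.orbitMap_mem hp s) _ hp
    exact ⟨_, orbitMap_stepLabel_mem smul_self_eq_imp hX hD hS (hX.orbitMap_mem hp)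
      (fun s _ => hyX s) (fun s _ => hyF s)
      (fun s _ g hg => funext fun k => hyE s g k (Or.inl hg)) 1⟩
  · rintro x ⟨hxX, hxS, hxF⟩ g
    have hmark : (g • x).mark n = {h : G | h • g ∈ x.mark n} := rfl
    refine ⟨hX.smul_mem x hxX g, ?_, ?_⟩
    · rw [hmark]; exact hxS.preimage_smul smul_self_eq_imp g
    · rw [hmark]
      intro s hs f hf k hk
      rw [Config.smul_apply, mul_assoc]
      exact hxF _ hs f hf k hk
  · intro z hz
    have hmk : ∀ {x : Config G} {g d : G}, d ∈ D ∪ F →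
        (∀ v ∈ V ∪ D ∪ F, ∀ k < n + 1, z (v * g) k = x (v * g) k) →
        (d * g ∈ z.mark n ↔ d * g ∈ x.mark n) := by
      intro x g d hd h
      have hd' : d ∈ V ∪ D ∪ F := hd.elim (fun h => Or.inl (Or.inr h)) Or.inr
      simp only [Config.mark, Set.mem_ofPred_eq, h d hd' n (Nat.lt_succ_self n)]
    refine ⟨hX.mem_of_local z fun g => ?_, ⟨?_, ?_⟩, ?_⟩
    · obtain ⟨x, hx, h⟩ := hz g
      exact ⟨x, hx.1, fun v hv k hk => h v (Or.inl (Or.inl hv)) k (by omega)⟩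
    · intro s hs d hd hds
      obtain ⟨x, hx, h⟩ := hz s
      have h1 := (hmk (Or.inl hD1) h).1 (by simpa using hs)
      rw [one_mul] at h1
      exact hx.2.1.spaced s h1 d hd ((hmk (Or.inl hd) h).1 hds)
    · intro g
      obtain ⟨x, hx, h⟩ := hz g
      obtain ⟨d, hd, hdg⟩ := hx.2.1.exists_smul_mem g
      exact ⟨d, hd, (hmk (Or.inl hd) h).2 hdg⟩
    · intro s hs f hf k hk
      obtain ⟨x, hx, h⟩ := hz s
      have h1 := (hmk (Or.inl hD1) h).1 (by simpa using hs)
      rw [one_mul] at h1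
      rw [h f (Or.inr hf) k (by omega)]
      exact hx.2.2 s h1 f hf k hk
  · exact hE'

end Stage

/-! ### Borel labels and refinements -/

section Borel

variable {G : Type u}

theorem measurable_config_iff {α : Type*} [MeasurableSpace α] {f : α → Config G} :
    Measurable f ↔ ∀ g k, Measurable fun a => f a g k := by
  refine ⟨fun h g k => (measurable_pi_apply k).comp ((measurable_pi_apply g).comp h), fun h => ?_⟩
  exact measurable_pi_iff.2 fun g => measurable_pi_iff.2 fun k => h g k

theorem continuous_config_apply (g : G) (k : ℕ) : Continuous fun x : Config G => x g k :=
  (continuous_apply k).comp (continuous_apply (A := fun _ : G => ℕ → Bool × Bool) g)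

variable [Group G]

theorem isOpen_setOf_agree {W : Set G} (hW : W.Finite) (n : ℕ) (y : Config G) (t : G) :
    IsOpen {x : Config G | ∀ w ∈ W, ∀ k < n, x (w * t) k = y (w * t) k} := by
  have : {x : Config G | ∀ w ∈ W, ∀ k < n, x (w * t) k = y (w * t) k} =
      ⋂ w ∈ W, ⋂ k ∈ Set.Iio n, (fun x : Config G => x (w * t) k) ⁻¹' {y (w * t) k} := by
    ext x; simp
  rw [this]
  exact hW.isOpen_biInter fun w _ => (Set.finite_Iio n).isOpen_biInter fun k _ =>
    (isOpen_discrete _).preimage (continuous_config_apply _ _)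

theorem IsStage.isClosed {n : ℕ} {V E : Set G} {X : Set (Config G)} (hX : IsStage n V E X) :
    IsClosed X := by
  rw [← isOpen_compl_iff, isOpen_iff_forall_mem_open]
  intro z hz
  have : ∃ g, ∀ x ∈ X, ¬ ∀ v ∈ V, ∀ k < n, z (v * g) k = x (v * g) k := by
    by_contra! h
    exact hz (hX.mem_of_local z h)
  obtain ⟨g, hg⟩ := this
  refine ⟨_, fun x hx hxX => hg x hxX fun v hv k hk => (hx v hv k hk).symm,
    isOpen_setOf_agree hX.finite_window n z g, fun _ _ _ _ => rfl⟩

theorem measurable_orbitMap {Z : Type v} [MeasurableSpace Z] [MulAction G Z]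
    (hmeas : ∀ g : G, Measurable fun z : Z => g • z) {ℓ : Z → ℕ → Bool × Bool}
    (hℓ : Measurable ℓ) : Measurable (orbitMap ℓ : Z → Config G) :=
  measurable_pi_iff.2 fun g => hℓ.comp (hmeas g)

/-- A set that is spaced by the quotients of `B` has measure at most `1 / |B|`. -/
theorem card_mul_measure_le_one {Z : Type v} [MeasurableSpace Z] [MulAction G Z]
    (hfree : ∀ (z : Z) (g : G), g • z = z → g = 1) {μ : Measure Z} [IsProbabilityMeasure μ]
    (hμ : ∀ g : G, MeasurePreserving (fun z : Z => g • z) μ μ) {D : Set G} {S : Set Z}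
    (hSm : MeasurableSet S) (hS : Spaced D S) (B : Finset G)
    (hB : ∀ b ∈ B, ∀ b' ∈ B, b'⁻¹ * b ∈ D) : B.card * μ S ≤ 1 := by
  have hdisj : (B : Set G).PairwiseDisjoint fun b => (fun z : Z => b⁻¹ • z) ⁻¹' S := by
    intro b hb b' hb' hne
    rw [Function.onFun, Set.disjoint_left]
    intro z hz hz'
    have := hfree _ _ (hS _ hz _ (hB b hb b' hb') (by rw [← mul_smul]; simpa using hz'))
    exact hne (inv_mul_eq_one.1 this).symm
  have h := measure_biUnion_finset (μ := μ) hdisj fun b _ => (hμ b⁻¹).measurable hSm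
  rw [Finset.sum_congr rfl fun b _ => (hμ b⁻¹).measure_preimage hSm.nullMeasurableSet,
    Finset.sum_const, nsmul_eq_mul] at h
  rw [← h]
  exact prob_le_one

variable [Countable G]

instance : BorelSpace (Config G) := inferInstanceAs (BorelSpace (G → ℕ → Bool × Bool))

/-- The patching in a stage can be done in a Borel way: only finitely many patches are possible,
and one takes the first that works. -/
theorem IsStage.exists_measurable_patch {n : ℕ} {V E : Set G} {X : Set (Config G)}
    (hX : IsStage n V E X) {F : Set G} (hF : F.Finite) {p : Config G} (hp : p ∈ X) :
    ∃ c : Config G → Config G, Measurable c ∧ ∀ x ∈ X, c x ∈ X ∧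
      (∀ f ∈ F, ∀ k < n, c x f k = p f k) ∧ ∀ g k, g ∉ E * F ∨ n ≤ k → c x g k = x g k := by
  classical
  have hQfin : (E * F).Finite := hX.finite_margin.mul hF
  have : Finite ↥(E * F) := hQfin
  obtain ⟨e, he⟩ := exists_surjective_nat (↥(E * F) → Fin n → Bool × Bool)
  let M : ℕ → Config G → Config G := fun i x g k =>
    if h : g ∈ E * F ∧ k < n then e i ⟨g, h.1⟩ ⟨k, h.2⟩ else x g k
  have hM : ∀ i, Measurable (M i) := by
    intro i
    refine measurable_config_iff.2 fun g k => ?_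
    by_cases h : g ∈ E * F ∧ k < n
    · simp only [M, dif_pos h]; exact measurable_const
    · simp only [M, dif_neg h]; exact (continuous_config_apply g k).measurable
  let P : Config G → ℕ → Prop := fun x i => x ∉ X ∨
    (M i x ∈ X ∧ ∀ f ∈ F, ∀ k < n, M i x f k = p f k)
  have hP : ∀ x, ∃ i, P x i := by
    intro x
    by_cases hx : x ∈ X
    · obtain ⟨x', hx'X, hx'p, hx'x⟩ := hX.exists_patch F hF x hx p hp
      obtain ⟨i, hi⟩ := he fun g k => x' g k
      have : M i x = x' := by
        funext g k
        by_cases h : g ∈ E * F ∧ k < n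
        · simp only [M, dif_pos h, hi]
        · simp only [M, dif_neg h]
          rw [hx'x g k]
          by_cases hg : g ∈ E * F
          · exact Or.inr (not_lt.1 fun hk => h ⟨hg, hk⟩)
          · exact Or.inl hg
      exact ⟨i, Or.inr ⟨this ▸ hx'X, this ▸ hx'p⟩⟩
    · exact ⟨0, Or.inl hx⟩
  have hXm : MeasurableSet X := hX.isClosed.measurableSet
  have hPm : ∀ i, MeasurableSet {x | P x i} := by
    intro i
    have : {x | P x i} = Xᶜ ∪ (M i ⁻¹' X ∩ ⋂ f ∈ F, ⋂ k ∈ Set.Iio n,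
        (fun x => M i x f k) ⁻¹' {p f k}) := by
      ext x; simp [P]
    rw [this]
    refine hXm.compl.union ((hM i hXm).inter (MeasurableSet.biInter hF.countable fun f _ =>
      MeasurableSet.biInter (Set.to_countable _) fun k _ => ?_))
    exact measurable_config_iff.1 (hM i) f k (measurableSet_singleton _)
  have hN : Measurable fun x => Nat.find (hP x) := measurable_find hP hPm
  refine ⟨fun x => M (Nat.find (hP x)) x, ?_, ?_⟩
  · have : Measurable fun q : ℕ × Config G => M q.1 q.2 :=
      measurable_from_prod_countable_right fun i => hM i
    exact this.comp (hN.prodMk measurable_id)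
  · intro x hx
    obtain ⟨h1, h2⟩ := (Nat.find_spec (hP x)).resolve_left (not_not.2 hx)
    refine ⟨h1, h2, fun g k hgk => dif_neg ?_⟩
    rintro ⟨hg, hk⟩
    exact hgk.elim (fun h => h hg) (fun h => absurd hk (not_lt.2 h))

theorem measurable_glue {Z : Type v} [MeasurableSpace Z] [MulAction G Z]
    (hmeas : ∀ g : G, Measurable fun z : Z => g • z)
    (hfree : ∀ (z : Z) (g : G), g • z = z → g = 1) {V Q : Set G} (hV : 1 ∈ V) {S : Set Z}
    (hSm : MeasurableSet S) (hS : Spaced (conflictSet V Q) S) {y : Z → Config G}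
    (hy : Measurable y) {ℓ : Z → ℕ → Bool × Bool} (hℓ : Measurable ℓ) :
    Measurable (glue Q S y ℓ) := by
  intro B hB
  have : glue Q S y ℓ ⁻¹' B =
      (⋃ q ∈ Q, (fun z => q⁻¹ • z) ⁻¹' S ∩ (fun z => y (q⁻¹ • z) q) ⁻¹' B) ∪
      ((⋃ q ∈ Q, (fun z => q⁻¹ • z) ⁻¹' S)ᶜ ∩ ℓ ⁻¹' B) := by
    ext z
    by_cases h : ∃ q ∈ Q, q⁻¹ • z ∈ S
    · have hz : ∀ q ∈ Q, q⁻¹ • z ∈ S → glue Q S y ℓ z = y (q⁻¹ • z) q := by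
        intro q hq hs
        have := glue_smul hfree hV hS y ℓ hs hq
        rwa [smul_inv_smul] at this
      simp only [Set.mem_preimage, Set.mem_union, Set.mem_iUnion, Set.mem_inter_iff,
        Set.mem_compl_iff]
      constructor
      · intro hzB
        obtain ⟨q, hq, hs⟩ := h
        exact Or.inl ⟨q, hq, hs, hz q hq hs ▸ hzB⟩
      · rintro (⟨q, hq, hs, hqB⟩ | ⟨h', -⟩)
        · rwa [hz q hq hs]
        · obtain ⟨q, hq, hs⟩ := h
          exact absurd ⟨q, hq, hs⟩ h'
    · have h' := h
      push Not at h'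
      simp only [Set.mem_preimage, Set.mem_union, Set.mem_iUnion, Set.mem_inter_iff,
        Set.mem_compl_iff, glue_of_notMem y ℓ h']
      constructor
      · exact fun hB => Or.inr ⟨fun ⟨q, hq, hs⟩ => h' q hq hs, hB⟩
      · rintro (⟨q, hq, hs, -⟩ | ⟨-, hB⟩)
        · exact absurd hs (h' q hq)
        · exact hB
  rw [this]
  have hQ : Q.Countable := Set.to_countable _
  exact (MeasurableSet.biUnion hQ fun q _ => (hmeas _ hSm).inter
    (((measurable_pi_apply q).comp (hy.comp (hmeas _))) hB)).union
    ((MeasurableSet.biUnion hQ fun q _ => hmeas _ hSm).compl.inter (hℓ hB))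

/-- `X'` is contained in `X`, and every Borel map of a free Borel action to `X` can be changed to
one to `X'`, so that on the first `n` tracks the change is confined to a set of measure at
most `2⁻ᵐ`, and on the other tracks the data stay the same. -/
def Refines (m n : ℕ) (X X' : Set (Config G)) : Prop :=
  X' ⊆ X ∧ ∀ (Z : Type w) [MeasurableSpace Z] [StandardBorelSpace Z] [MulAction G Z],
    (∀ g : G, Measurable fun z : Z => g • z) → (∀ (z : Z) (g : G), g • z = z → g = 1) →
    ∀ ℓ : Z → ℕ → Bool × Bool, Measurable ℓ → (∀ z, orbitMap ℓ z ∈ X) →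
    ∃ (ℓ' : Z → ℕ → Bool × Bool) (N : Set Z), Measurable ℓ' ∧ MeasurableSet N ∧
      (∀ z, orbitMap ℓ' z ∈ X') ∧
      (∀ z ∉ N, ∀ k < n, ℓ' z k = ℓ z k) ∧ (∀ z, ∀ k ≥ n, (ℓ' z k).1 = (ℓ z k).1) ∧
      ∀ μ : Measure Z, IsProbabilityMeasure μ →
        (∀ g : G, MeasurePreserving (fun z : Z => g • z) μ μ) → 2 ^ m * μ N ≤ 1

theorem IsStage.refines_stepSet (m : ℕ) {n : ℕ} {V E D F : Set G} {X : Set (Config G)}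
    (hX : IsStage n V E X) (hF : F.Finite) {p : Config G} (hp : p ∈ X)
    (hDfin : D.Finite) (hDinv : ∀ d ∈ D, d⁻¹ ∈ D) (hD1 : 1 ∈ D)
    (hD : conflictSet V (E * F) ⊆ D) (B : Finset G) (hBcard : 2 ^ m * (E * F).ncard ≤ B.card)
    (hB : ∀ b ∈ B, ∀ b' ∈ B, b'⁻¹ * b ∈ D) :
    Refines.{u, w} m n X (stepSet n X D F p) := by
  refine ⟨fun x hx => hx.1, fun Z _ _ _ hmeas hfree ℓ hℓm hℓ => ?_⟩
  obtain ⟨S, -, hSm, hS⟩ := Spaced.exists_measurableSet_maxSpaced (Z := Z) hmeas hDfin hDinv hD1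
    (S₀ := ∅) (by simp [Spaced]) MeasurableSet.empty
  obtain ⟨c, hcm, hc⟩ := hX.exists_measurable_patch hF hp
  have hQfin : (E * F).Finite := hX.finite_margin.mul hF
  have hgm : Measurable (glue (E * F) S (fun z => c (orbitMap ℓ z)) ℓ) :=
    measurable_glue hmeas hfree hX.one_mem_window hSm (hS.spaced.mono hD subset_rfl)
      (hcm.comp (measurable_orbitMap hmeas hℓm)) hℓm
  let Q : Finset G := hQfin.toFinset
  refine ⟨stepLabel n (E * F) S (fun z => c (orbitMap ℓ z)) ℓ,
    ⋃ q ∈ Q, (fun z : Z => q⁻¹ • z) ⁻¹' S, ?_, ?_, ?_, ?_, ?_, ?_⟩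
  · refine measurable_pi_iff.2 fun k => ?_
    by_cases hk : k = n
    · simp only [stepLabel, hk, if_true]
      refine Measurable.prodMk (measurable_fst.comp ((measurable_pi_apply n).comp hℓm)) ?_
      refine measurable_to_bool ?_
      convert hSm using 1
      ext; simp
    · simp only [stepLabel, hk, if_false]
      exact (measurable_pi_apply k).comp hgm
  · exact Finset.measurableSet_biUnion _ fun q _ => hmeas _ hSm
  · exact orbitMap_stepLabel_mem hfree hX hD hS hℓ (fun s _ => (hc _ (hℓ s)).1)
      (fun s _ => (hc _ (hℓ s)).2.1)
      (fun s _ g hg => funext fun k => (hc _ (hℓ s)).2.2 g k (Or.inl hg))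
  · intro z hz k hk
    rw [stepLabel, if_neg hk.ne, glue_of_notMem]
    intro q hq hs
    exact hz (Set.mem_biUnion (x := q) (by simpa [Q] using hq) hs)
  · intro z k hk
    rw [stepLabel]
    split_ifs with h
    · rw [h]
    · by_cases hz : ∃ q ∈ E * F, q⁻¹ • z ∈ S
      · obtain ⟨q, hq, hs⟩ := hz
        have := glue_smul hfree hX.one_mem_window (hS.spaced.mono hD subset_rfl)
          (fun z => c (orbitMap ℓ z)) ℓ hs hq
        rw [smul_inv_smul] at this
        rw [this, (hc _ (hℓ _)).2.2 q k (Or.inr hk)]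
        simp [orbitMap]
      · push Not at hz
        rw [glue_of_notMem _ _ hz]
  · intro μ hμ1 hμ
    have h1 : μ (⋃ q ∈ Q, (fun z : Z => q⁻¹ • z) ⁻¹' S) ≤ Q.card * μ S := by
      refine (measure_biUnion_finset_le _ _).trans ?_
      rw [Finset.sum_congr rfl fun b _ => (hμ b⁻¹).measure_preimage hSm.nullMeasurableSet,
        Finset.sum_const, nsmul_eq_mul]
    have h2 := card_mul_measure_le_one hfree hμ hSm hS.spaced B hB
    have h3 : ((2 ^ m * Q.card : ℕ) : ENNReal) ≤ B.card := by
      rw [Set.ncard_eq_toFinset_card _ hQfin] at hBcard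
      exact_mod_cast hBcard
    calc 2 ^ m * μ (⋃ q ∈ Q, (fun z : Z => q⁻¹ • z) ⁻¹' S) ≤ 2 ^ m * (Q.card * μ S) := by gcongr
      _ = ((2 ^ m * Q.card : ℕ) : ENNReal) * μ S := by push_cast; rw [mul_assoc]
      _ ≤ B.card * μ S := by gcongr
      _ ≤ 1 := h2

end Borel

/-! ### Forcing joint occurrences of patterns -/

section Joint

variable {G : Type u} [Group G]

theorem Spaced.mul {D T U : Set G} (hT : Spaced D T) (hU : Spaced (T⁻¹ * D * T) U) :
    Spaced D (T * U) := by
  rintro _ ⟨t, ht, u, hu, rfl⟩ d hd ⟨t', ht', u', hu', h⟩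
  have e : (t'⁻¹ * d * t) • u = u' := by
    simp only [smul_eq_mul] at h ⊢
    rw [mul_assoc, mul_assoc, ← h]; simp
  have h1 := hU u hu _ (Set.mul_mem_mul (Set.mul_mem_mul (Set.inv_mem_inv.2 ht') hd) ht)
    (e.symm ▸ hu')
  have h2 : t' = d * t := by
    have := smul_self_eq_imp _ _ h1
    rwa [mul_assoc, inv_mul_eq_one] at this
  have h3 := hT t ht d hd (by rw [smul_eq_mul, ← h2]; exact ht')
  simp only [smul_eq_mul] at h3 ⊢
  rw [← mul_assoc, h3]

/-- Finitely many stages contain points `p i` in which all families of patterns that occur in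
points of the stages on the window `W` occur at a common place. -/
theorem exists_rich_points [Infinite G] {ι : Type v} [Finite ι] {n : ℕ} {X : ι → Set (Config G)}
    (hX : ∀ i, ∃ V E, IsStage n V E (X i)) {W : Set G} (hW : W.Finite) :
    ∃ p : ι → Config G, (∀ i, p i ∈ X i) ∧ ∃ W' : Set G, W'.Finite ∧
      ∀ x : ι → Config G, (∀ i, x i ∈ X i) → ∃ c, ∀ w ∈ W, w * c ∈ W' ∧
        ∀ i, ∀ k < n, p i (w * c) k = x i w k := by
  classical
  choose V E hX using hX
  have : Finite ↥W := hW
  let P : Type _ := ι → W → Fin n → Bool × Bool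
  have := Fintype.ofFinite P
  have hMfin : (⋃ i, conflictSet (V i) (E i * W)).Finite := Set.finite_iUnion fun i =>
    conflictSet_finite (hX i).finite_window ((hX i).finite_margin.mul hW)
  obtain ⟨O, hOcard, hO⟩ := exists_finset_spaced (G := G) hMfin (Fintype.card P)
  have eq : P ≃ O := Fintype.equivOfCardEq (by simp [hOcard])
  -- `r i π` is a point of `X i` with pattern `π i` if there is one.
  have hr : ∀ (i : ι) (π : P), ∃ x ∈ X i,
      (∃ x ∈ X i, ∀ (w : W) (k : Fin n), x w k = π i w k) → ∀ (w : W) (k : Fin n),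
        x w k = π i w k := by
    intro i π
    by_cases h : ∃ x ∈ X i, ∀ (w : W) (k : Fin n), x w k = π i w k
    · obtain ⟨x, hx, hxπ⟩ := h
      exact ⟨x, hx, fun _ => hxπ⟩
    · obtain ⟨x, hx⟩ := (hX i).nonempty
      exact ⟨x, hx, fun h' => absurd h' h⟩
  choose r hrX hr using hr
  have hpt : ∀ i, ∃ q ∈ X i, ∀ π : P, ∀ w ∈ W, ∀ k < n, q (w * eq π) k = r i π w k := by
    intro i
    obtain ⟨x, hx⟩ := (hX i).nonempty
    obtain ⟨q, hqX, hqp, -, -⟩ := (hX i).exists_glue (Z := G) smul_self_eq_imp hW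
      (hO.mono (Set.subset_iUnion (fun i => conflictSet (V i) (E i * W)) i) subset_rfl)
      (p := fun o => if h : o ∈ O then r i (eq.symm ⟨o, h⟩) else x)
      (fun o => by split_ifs; exacts [hrX _ _, hx]) (ℓ := x) ((hX i).orbitMap_mem hx)
    refine ⟨q, ?_, fun π w hw k hk => ?_⟩
    · have := hqX 1
      rwa [orbitMap_one] at this
    · have := hqp (eq π) (eq π).2 w hw k hk
      rw [smul_eq_mul, dif_pos (eq π).2] at this
      rw [this]
      simp
  choose p hpX hp using hpt
  refine ⟨p, hpX, W * (O : Set G), hW.mul O.finite_toSet, fun x hx => ?_⟩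
  let π : P := fun i w k => x i w k
  refine ⟨eq π, fun w hw => ⟨Set.mul_mem_mul hw (eq π).2, fun i k hk => ?_⟩⟩
  rw [hp i π w hw k hk]
  exact hr i π ⟨x i, hx i, fun _ _ => rfl⟩ ⟨w, hw⟩ ⟨k, hk⟩

variable [Countable G]

/-- A stage can be refined so that `γ` has no fixed points: a maximal `{1, γ, γ⁻¹}`-spaced set
contains, for every `h`, one but not all of `h`, `γ * h` and `γ * γ * h`. -/
theorem exists_refinement_smul_ne (m : ℕ) {n : ℕ} {X : Set (Config G)}
    (hX : ∃ V E, IsStage n V E X) {γ : G} (hγ : γ ≠ 1) :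
    ∃ X' : Set (Config G), (∃ V E, IsStage (n + 1) V E X') ∧ Refines.{u, w} m n X X' ∧
      ∀ x ∈ X', γ • x ≠ x := by
  obtain ⟨V, E, hX⟩ := hX
  obtain ⟨p, hp⟩ := hX.nonempty
  have hDfin : ({1, γ, γ⁻¹} : Set G).Finite := Set.toFinite _
  have hDinv : ∀ d ∈ ({1, γ, γ⁻¹} : Set G), d⁻¹ ∈ ({1, γ, γ⁻¹} : Set G) := by
    rintro d (rfl | rfl | rfl) <;> simp
  have hD : conflictSet V (E * ∅) ⊆ ({1, γ, γ⁻¹} : Set G) := by simp [conflictSet]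
  refine ⟨stepSet n X {1, γ, γ⁻¹} ∅ p,
    hX.exists_isStage_stepSet Set.finite_empty hp hDfin hDinv (by simp) hD,
    hX.refines_stepSet m Set.finite_empty hp hDfin hDinv (by simp) hD ∅ (by simp) (by simp), ?_⟩
  rintro x ⟨-, hx, -⟩ h
  have hinv : ∀ g, (g * γ ∈ x.mark n ↔ g ∈ x.mark n) := by
    intro g
    have := congrFun h g
    rw [Config.smul_apply] at this
    simp only [Config.mark, Set.mem_ofPred_eq, this]
  have h1 : (1 : G) ∉ x.mark n := by
    intro h1
    have := hx.spaced 1 h1 γ (by simp) (by simpa using (hinv 1).2 h1)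
    exact hγ (by simpa using this)
  have h2 : γ ∉ x.mark n := fun h2 => h1 ((hinv 1).1 (by simpa using h2))
  obtain ⟨d, hd, hdx⟩ := hx.exists_smul_mem 1
  rw [smul_eq_mul, mul_one] at hdx
  rcases hd with rfl | rfl | rfl
  · exact h1 hdx
  · exact h2 hdx
  · exact h1 (by simpa using (hinv γ⁻¹).2 hdx)

variable [Infinite G]

/-- For stages `X i`, `i ∈ J`, and points `p i ∈ X i` there are refinements `X' i` such that the
patterns of all the `p i` occur at a common place in any family of points of the `X' i`; moreover
that place can be found in a finite set `T` which is as sparse as one likes. The latter is what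
makes the induction on `J` work: given `T` for `J`, force on the next stage its pattern at all
places `t * o` with `t ∈ T` and `o ∈ O`, for a large sparse set `O`. -/
theorem exists_joint_refinement {ι : Type v} (m : ℕ) {n : ℕ} {X : ι → Set (Config G)}
    (hX : ∀ i, ∃ V E, IsStage n V E (X i)) {p : ι → Config G} (hp : ∀ i, p i ∈ X i) {W : Set G}
    (hW : W.Finite) (J : Finset ι) :
    ∀ D : Set G, D.Finite → ∃ X' : ι → Set (Config G),
      (∀ i ∈ J, (∃ V E, IsStage (n + 1) V E (X' i)) ∧ Refines.{u, w} m n (X i) (X' i)) ∧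
      ∃ T : Set G, T.Finite ∧ Spaced D T ∧ ∀ y : ι → Config G, (∀ i ∈ J, y i ∈ X' i) →
        ∃ t ∈ T, ∀ i ∈ J, ∀ w ∈ W, ∀ k < n, y i (w * t) k = p i w k := by
  classical
  induction J using Finset.induction_on with
  | empty =>
    exact fun D _ => ⟨X, by simp, {1}, Set.finite_singleton 1,
      fun s hs d _ hds => hds.trans hs.symm, fun y _ => ⟨1, rfl, by simp⟩⟩
  | insert a J ha ih =>
    intro D hDfin
    obtain ⟨V, E, hXa⟩ := hX a
    have hVfin := hXa.finite_window
    have hEfin := hXa.finite_margin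
    have hM₀fin : (conflictSet V (E * W)).Finite := conflictSet_finite hVfin (hEfin.mul hW)
    obtain ⟨X', hX', T, hTfin, hTsp, hT⟩ :=
      ih (D ∪ conflictSet V (E * W)) (hDfin.union hM₀fin)
    set Q₀ : Set G := E * (W * T)
    have hQ₀fin : Q₀.Finite := hEfin.mul (hW.mul hTfin)
    let Qf : Finset G := hQ₀fin.toFinset
    have hKfin : (conflictSet V Q₀).Finite := conflictSet_finite hVfin hQ₀fin
    let K : Finset G := hKfin.toFinset
    obtain ⟨O, hO0, hOsp, hO⟩ := exists_spaced_hitting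
      ((hTfin.inv.mul hM₀fin).mul hTfin : (T⁻¹ * conflictSet V (E * W) * T).Finite)
      ((hTfin.inv.mul hDfin).mul hTfin : (T⁻¹ * D * T).Finite)
      (K.card + (2 ^ m * Qf.card) ^ 2 + 1)
    obtain ⟨B, hBcard, -⟩ := exists_finset_spaced (G := G) Set.finite_empty
      (2 ^ m * (Qf.card * O.card))
    -- The spacing of the new markers has to be of size at most a constant times `|O| ^ 2`.
    let R : Finset G := O⁻¹ * K * O ∪ B⁻¹ * B ∪ {1}
    have hRcard : R.card ≤ (K.card + (2 ^ m * Qf.card) ^ 2 + 1) * O.card ^ 2 := by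
      have h1 : (O⁻¹ * K * O).card ≤ K.card * O.card ^ 2 := by
        refine Finset.card_mul_le.trans ?_
        have := Nat.mul_le_mul_right O.card (Finset.card_mul_le (s := O⁻¹) (t := K))
        rw [Finset.card_inv] at this
        nlinarith
      have h2 : (B⁻¹ * B).card ≤ (2 ^ m * Qf.card) ^ 2 * O.card ^ 2 := by
        refine Finset.card_mul_le.trans ?_
        rw [Finset.card_inv, hBcard]
        exact le_of_eq (by ring)
      have h3 : 1 ≤ O.card ^ 2 := Nat.one_le_pow _ _ (Finset.card_pos.2 hO0)
      calc R.card ≤ (O⁻¹ * K * O).card + (B⁻¹ * B).card + 1 :=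
            (Finset.card_union_le _ _).trans
              (Nat.add_le_add (Finset.card_union_le _ _) (by simp))
        _ ≤ K.card * O.card ^ 2 + (2 ^ m * Qf.card) ^ 2 * O.card ^ 2 + O.card ^ 2 := by omega
        _ = _ := by ring
    obtain ⟨U, hUfin, hUsp, hU⟩ := hO R hRcard
    -- A point of `X a` with the pattern `p a` at all places of `T * O`.
    have hTO : Spaced (conflictSet V (E * W)) (T * (O : Set G)) :=
      (hTsp.mono Set.subset_union_right subset_rfl).mul hOsp
    obtain ⟨q, hqX, hqp, -, -⟩ := hXa.exists_glue (Z := G) smul_self_eq_imp hW hTO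
      (p := fun _ => p a) (fun _ => hp a) (ℓ := p a) (hXa.orbitMap_mem (hp a))
    have hqX : (q : Config G) ∈ X a := by
      have := hqX 1
      rwa [orbitMap_one] at this
    set F : Set G := W * T * O with hF
    have hFfin : F.Finite := (hW.mul hTfin).mul O.finite_toSet
    have hEF : E * F = Q₀ * O := by simp only [hF, Q₀, mul_assoc]
    have hDR : conflictSet V (E * F) ⊆ (R : Set G) := by
      have : conflictSet V (E * F) = (O : Set G)⁻¹ * conflictSet V Q₀ * O := by
        simp only [hEF, conflictSet, mul_inv_rev, mul_assoc]
      rw [this]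
      intro g hg
      simp only [R, K, Finset.coe_union, Finset.coe_mul, Finset.coe_inv,
        Set.Finite.coe_toFinset]
      exact Or.inl (Or.inl hg)
    have hR1 : (1 : G) ∈ (R : Set G) := by simp [R]
    have hRinv : ∀ d ∈ (R : Set G), d⁻¹ ∈ (R : Set G) := by
      intro d hd
      simp only [R, K, Finset.coe_union, Finset.coe_mul, Finset.coe_inv,
        Set.Finite.coe_toFinset, Finset.coe_singleton] at hd ⊢
      rcases hd with (hd | hd) | hd
      · obtain ⟨_, ⟨o, ho, c, hc, rfl⟩, o', ho', rfl⟩ := hd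
        refine Or.inl (Or.inl ⟨_, ⟨o'⁻¹, Set.inv_mem_inv.2 ho', c⁻¹, inv_mem_conflictSet hc, rfl⟩,
          o⁻¹, ho, ?_⟩)
        simp [mul_assoc]
      · obtain ⟨b, hb, b', hb', rfl⟩ := hd
        exact Or.inl (Or.inr ⟨b'⁻¹, Set.inv_mem_inv.2 hb', b⁻¹, hb, by simp⟩)
      · rw [Set.mem_singleton_iff.1 hd, inv_one]; exact Or.inr rfl
    have hEFcard : 2 ^ m * (E * F).ncard ≤ B.card := by
      rw [hBcard, hEF]
      refine Nat.mul_le_mul_left _ ?_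
      have : Q₀ * (O : Set G) = ((Qf * O : Finset G) : Set G) := by simp [Qf]
      rw [this, Set.ncard_coe_finset]
      exact Finset.card_mul_le
    have hBR : ∀ b ∈ B, ∀ b' ∈ B, b'⁻¹ * b ∈ (R : Set G) := by
      intro b hb b' hb'
      simp only [R, Finset.coe_union, Finset.coe_mul]
      exact Or.inl (Or.inr ⟨b'⁻¹, by simpa using hb', b, hb, rfl⟩)
    have hstage := hXa.exists_isStage_stepSet hFfin hqX R.finite_toSet hRinv hR1 hDR
    have href := hXa.refines_stepSet m hFfin hqX R.finite_toSet hRinv hR1 hDR B hEFcard hBR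
    refine ⟨Function.update X' a (stepSet n (X a) R F q), ?_, T * U, hTfin.mul hUfin,
      (hTsp.mono Set.subset_union_left subset_rfl).mul hUsp, ?_⟩
    · intro i hi
      rcases Finset.mem_insert.1 hi with rfl | hi
      · rw [Function.update_self]
        exact ⟨hstage, href⟩
      · rw [Function.update_of_ne (ne_of_mem_of_not_mem hi ha)]
        exact hX' i hi
    · intro y hy
      have hya := hy a (Finset.mem_insert_self a J)
      rw [Function.update_self] at hya
      obtain ⟨s, hsR, hs⟩ := hya.2.1.exists_smul_mem 1
      rw [smul_eq_mul, mul_one] at hs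
      obtain ⟨o, ho, hos⟩ := hU s hsR
      obtain ⟨t, ht, hty⟩ := hT (fun i => (o * s) • y i) fun i hi => by
        have := hy i (Finset.mem_insert_of_mem hi)
        rw [Function.update_of_ne (ne_of_mem_of_not_mem hi ha)] at this
        obtain ⟨⟨V', E', hst⟩, -⟩ := hX' i hi
        exact hst.smul_mem _ this _
      refine ⟨t * (o * s), Set.mul_mem_mul ht hos, fun i hi w hw k hk => ?_⟩
      rcases Finset.mem_insert.1 hi with rfl | hi
      · have h1 := hya.2.2 s hs (w * t * o) (Set.mul_mem_mul (Set.mul_mem_mul hw ht) ho) k hk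
        have h2 := hqp (t * o) (Set.mul_mem_mul ht ho) w hw k hk
        rw [smul_eq_mul] at h2
        rw [← h2, ← mul_assoc w t o, ← h1]
        simp only [mul_assoc]
      · have := hty i hi w hw k hk
        rwa [Config.smul_apply, mul_assoc] at this

/-- Refinements of finitely many stages such that every family of patterns of the stages on the
window `W` occurs at a common place in every family of points of the refinements. -/
theorem exists_rich_refinement {ι : Type v} [Finite ι] (m : ℕ) {n : ℕ} {X : ι → Set (Config G)}
    (hX : ∀ i, ∃ V E, IsStage n V E (X i)) {W : Set G} (hW : W.Finite) :
    ∃ X' : ι → Set (Config G),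
      (∀ i, (∃ V E, IsStage (n + 1) V E (X' i)) ∧ Refines.{u, w} m n (X i) (X' i)) ∧
      ∀ x y : ι → Config G, (∀ i, x i ∈ X i) → (∀ i, y i ∈ X' i) →
        ∃ t, ∀ i, ∀ w ∈ W, ∀ k < n, y i (w * t) k = x i w k := by
  have := Fintype.ofFinite ι
  obtain ⟨p, hp, W', hW', hpW⟩ := exists_rich_points hX hW
  obtain ⟨X', hX', T, -, -, hT⟩ := exists_joint_refinement.{u, v, w} m hX hp hW' Finset.univ ∅
    Set.finite_empty
  refine ⟨X', fun i => hX' i (Finset.mem_univ i), fun x y hx hy => ?_⟩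
  obtain ⟨t, -, ht⟩ := hT y fun i _ => hy i
  obtain ⟨c, hc⟩ := hpW x hx
  refine ⟨c * t, fun i w hw k hk => ?_⟩
  rw [← mul_assoc, ht i (Finset.mem_univ i) _ (hc w hw).1 k hk, (hc w hw).2 i k hk]

end Joint

/-! ### The tree of stages -/

section Tree

variable {G : Type u} [Group G] [Countable G] [Infinite G]

/-- A binary tree of stages. Along every branch `σ` the stages are successive refinements. At the
even levels all patterns of the nodes of that level are made to occur jointly, on the first `n`
tracks and on the window `{e 0, …, e (n - 1)}`; at the odd levels one makes a group element act
without fixed points. -/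
theorem exists_tree (e : ℕ → G) :
    ∃ X : ℕ → (ℕ → Bool) → Set (Config G),
      (∀ n σ, ∃ V E, IsStage n V E (X n σ)) ∧ (∀ σ, X 0 σ = Set.univ) ∧
      (∀ n σ, Refines.{u, w} n n (X n σ) (X (n + 1) σ)) ∧
      (∀ n, Even n → ∀ J : Finset (ℕ → Bool),
        (∀ σ ∈ J, ∀ τ ∈ J, (∀ k < n, σ k = τ k) → σ = τ) →
        ∀ x y : (ℕ → Bool) → Config G, (∀ σ ∈ J, x σ ∈ X n σ) → (∀ σ ∈ J, y σ ∈ X (n + 1) σ) →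
        ∃ t, ∀ σ ∈ J, ∀ j < n, ∀ k < n, y σ (e j * t) k = x σ (e j) k) ∧
      ∀ n, Odd n → e (n / 2) ≠ 1 → ∀ σ, ∀ x ∈ X (n + 1) σ, e (n / 2) • x ≠ x := by
  classical
  have hstep : ∀ n (X : (Fin n → Bool) → Set (Config G)), (∀ s, ∃ V E, IsStage n V E (X s)) →
      ∃ X' : (Fin n → Bool) → Set (Config G),
        (∀ s, (∃ V E, IsStage (n + 1) V E (X' s)) ∧ Refines.{u, w} n n (X s) (X' s)) ∧
        (Even n → ∀ x y : (Fin n → Bool) → Config G, (∀ s, x s ∈ X s) → (∀ s, y s ∈ X' s) →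
          ∃ t, ∀ s, ∀ g ∈ e '' Set.Iio n, ∀ k < n, y s (g * t) k = x s g k) ∧
        (Odd n → e (n / 2) ≠ 1 → ∀ s, ∀ x ∈ X' s, e (n / 2) • x ≠ x) := by
    intro n X hX
    by_cases hn : Odd n ∧ e (n / 2) ≠ 1
    · choose X' h1 h2 h3 using fun s => exists_refinement_smul_ne.{u, w} n (hX s) hn.2
      exact ⟨X', fun s => ⟨h1 s, h2 s⟩,
        fun h => absurd h (Nat.not_even_iff_odd.2 hn.1), fun _ _ => h3⟩
    · obtain ⟨X', h1, h2⟩ := exists_rich_refinement.{u, 0, w} n hX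
        ((Set.finite_Iio n).image e)
      exact ⟨X', h1, fun _ => h2, fun h h' => absurd ⟨h, h'⟩ hn⟩
  choose next hnext using hstep
  let A : ∀ n, {X : (Fin n → Bool) → Set (Config G) // ∀ s, ∃ V E, IsStage n V E (X s)} :=
    fun n => Nat.rec ⟨fun _ => Set.univ, fun _ => ⟨_, _, isStage_univ⟩⟩
      (fun n X => ⟨fun s => next n X.1 X.2 (Fin.init s), fun s => ((hnext n X.1 X.2).1 _).1⟩) n
  let r : ∀ n, (ℕ → Bool) → Fin n → Bool := fun n σ i => σ i
  have hA : ∀ n σ, (A (n + 1)).1 (r (n + 1) σ) = next n (A n).1 (A n).2 (r n σ) :=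
    fun n σ => rfl
  refine ⟨fun n σ => (A n).1 (r n σ), fun n σ => (A n).2 _, fun _ => rfl, fun n σ => ?_, ?_, ?_⟩
  · beta_reduce; rw [hA]; exact ((hnext n (A n).1 (A n).2).1 _).2
  · intro n hn J hJ x y hx hy
    beta_reduce at hx hy
    choose x₀ hx₀ using fun s => ((A n).2 s).choose_spec.choose_spec.nonempty
    choose y₀ hy₀ using fun s =>
      ((hnext n (A n).1 (A n).2).1 s).1.choose_spec.choose_spec.nonempty
    obtain ⟨t, ht⟩ := (hnext n (A n).1 (A n).2).2.1 hn
      (fun s => if h : ∃ σ ∈ J, r n σ = s then x h.choose else x₀ s)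
      (fun s => if h : ∃ σ ∈ J, r n σ = s then y h.choose else y₀ s) (by
        intro s
        split_ifs with h
        · have := hx _ h.choose_spec.1
          rwa [h.choose_spec.2] at this
        · exact hx₀ s) (by
        intro s
        split_ifs with h
        · have := hy _ h.choose_spec.1
          rw [hA] at this
          rwa [h.choose_spec.2] at this
        · exact hy₀ s)
    refine ⟨t, fun σ hσ j hj k hk => ?_⟩
    have h : ∃ τ ∈ J, r n τ = r n σ := ⟨σ, hσ, rfl⟩
    have hτ : h.choose = σ := hJ _ h.choose_spec.1 σ hσ fun k hk =>
      congrFun h.choose_spec.2 ⟨k, hk⟩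
    have := ht (r n σ) (e j) ⟨j, hj, rfl⟩ k hk
    simp only [dif_pos h, hτ] at this
    exact this
  · intro n hn he σ x hx
    beta_reduce at hx
    rw [hA] at hx
    exact (hnext n (A n).1 (A n).2).2.2 hn he _ x hx

end Tree

/-! ### Flows of configurations -/

section Flow

variable {G : Type u}

theorem exists_agree_subset {e : ℕ → G} (he : Function.Surjective e) {O : Set (Config G)}
    (hO : IsOpen O) {x : Config G} (hx : x ∈ O) :
    ∃ n, ∀ z : Config G, (∀ j < n, ∀ k < n, z (e j) k = x (e j) k) → z ∈ O := by
  by_contra! h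
  choose z hz hzO using h
  have : Filter.Tendsto z Filter.atTop (nhds x) := by
    refine tendsto_pi_nhds.2 fun g => tendsto_pi_nhds.2 fun k => ?_
    obtain ⟨j, rfl⟩ := he g
    refine tendsto_const_nhds.congr' ?_
    filter_upwards [Filter.eventually_gt_atTop (max j k)] with n hn
    exact (hz n j (lt_of_le_of_lt (le_max_left _ _) hn) k
      (lt_of_le_of_lt (le_max_right _ _) hn)).symm
  obtain ⟨n, hn⟩ := (this.eventually (hO.mem_nhds hx)).exists
  exact hzO n hn

variable [Group G]

instance : ContinuousConstSMul G (Config G) where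
  continuous_const_smul h := continuous_pi fun g =>
    continuous_apply (A := fun _ : G => ℕ → Bool × Bool) (g * h)

variable [Countable G]

instance : SecondCountableTopology (Config G) :=
  inferInstanceAs (SecondCountableTopology (G → ℕ → Bool × Bool))

instance : TopologicalSpace.MetrizableSpace (Config G) :=
  TopologicalSpace.metrizableSpace_of_t3_secondCountable _

instance : Small.{0} (Config G) := inferInstanceAs (Small.{0} (G → ℕ → Bool × Bool))

/-- A closed invariant set of configurations is (up to the choice of a universe) a flow. -/
theorem exists_flow {Y : Set (Config G)} (hY : IsClosed Y) (hinv : ∀ x ∈ Y, ∀ g : G, g • x ∈ Y) :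
    ∃ (A : GFlow.{u, 0} G) (ev : A.carrier → Config G), Topology.IsClosedEmbedding ev ∧
      Set.range ev = Y ∧ ∀ (g : G) (a : A.carrier), ev (g • a) = g • ev a := by
  let S : SubMulAction G (Config G) := ⟨Y, fun g x hx => hinv x hx g⟩
  have hS : IsClosed (S : Set (Config G)) := hY
  let h : S ≃ₜ Shrink.{0} S := Shrink.homeomorph S
  have hsmul : ∀ (g : G) (a : Shrink.{0} S), g • a = h (g • h.symm a) := fun _ _ => rfl
  have : CompactSpace S := isCompact_iff_compactSpace.1 hS.isCompact
  have : CompactSpace (Shrink.{0} S) := h.compactSpace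
  have : T2Space (Shrink.{0} S) := h.t2Space
  have : ContinuousConstSMul G (Shrink.{0} S) := ⟨fun g => by
    simp only [hsmul]
    exact h.continuous.comp (Continuous.subtype_mk
      ((continuous_subtype_val.comp h.symm.continuous).const_smul g) _)⟩
  refine ⟨⟨Shrink.{0} S⟩, fun a => (h.symm a : Config G),
    hS.isClosedEmbedding_subtypeVal.comp h.symm.isClosedEmbedding, ?_, ?_⟩
  · ext x
    constructor
    · rintro ⟨a, rfl⟩
      exact (h.symm a).2
    · intro hx
      exact ⟨h ⟨x, hx⟩, by simp⟩
  · intro g a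
    change ((h.symm (h (g • h.symm a)) : S) : Config G) = _
    rw [h.symm_apply_apply]
    rfl

end Flow

/-! ### Realizing free systems -/

section Universal

open Filter Topology

variable {G : Type u} [Group G] [Countable G]

/-- Let `X 0, X 1, …` be successive refinements with intersection `Y`. A free Borel action maps to
`Y`, Borel measurably and, on a conull invariant set, injectively and equivariantly. -/
theorem exists_measurable_injOn {X : ℕ → Set (Config G)} (hX : ∀ n, ∃ V E, IsStage n V E (X n))
    (hX0 : X 0 = Set.univ) (href : ∀ n, Refines.{u, w} n n (X n) (X (n + 1)))
    {y₀ : Config G} (hy₀ : ∀ n, y₀ ∈ X n)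
    {Z : Type w} [MeasurableSpace Z] [StandardBorelSpace Z] [MulAction G Z]
    (hmeas : ∀ g : G, Measurable fun z : Z => g • z)
    (hfree : ∀ (z : Z) (g : G), g • z = z → g = 1) (μ : Measure Z) [IsProbabilityMeasure μ]
    (hμ : ∀ g : G, MeasurePreserving (fun z : Z => g • z) μ μ) :
    ∃ (Z' : Set Z) (f : Z → Config G), MeasurableSet Z' ∧ (∀ᵐ z ∂μ, z ∈ Z') ∧
      (∀ g : G, ∀ z ∈ Z', g • z ∈ Z') ∧ Measurable f ∧ (∀ z n, f z ∈ X n) ∧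
      (∀ g : G, ∀ z ∈ Z', f (g • z) = g • f z) ∧ Set.InjOn f Z' := by
  classical
  have hanti : Antitone X := antitone_nat_of_succ_le fun n => (href n).1
  obtain ⟨ψ, hψm, hψ⟩ :=
    MeasurableSpace.measurable_injection_nat_bool_of_countablySeparated Z
  let L : ℕ → Type w := fun n =>
    {ℓ : Z → ℕ → Bool × Bool // Measurable ℓ ∧ ∀ z, orbitMap ℓ z ∈ X n}
  -- Every bit of `ψ z` is stored on infinitely many tracks.
  let ℓ₀ : L 0 := ⟨fun z k => (ψ z k.unpair.1, false), by
    refine measurable_pi_iff.2 fun k => Measurable.prodMk ?_ measurable_const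
    exact (measurable_pi_apply _).comp hψm, fun z => hX0 ▸ trivial⟩
  have hnext : ∀ n (ℓ : L n), ∃ (ℓ' : L (n + 1)) (N : Set Z), MeasurableSet N ∧
      (∀ z ∉ N, ∀ k < n, ℓ'.1 z k = ℓ.1 z k) ∧ (∀ z, ∀ k ≥ n, (ℓ'.1 z k).1 = (ℓ.1 z k).1) ∧
      2 ^ n * μ N ≤ 1 := by
    intro n ℓ
    obtain ⟨ℓ', N, h1, h2, h3, h4, h5, h6⟩ := (href n).2 Z hmeas hfree ℓ.1 ℓ.2.1 ℓ.2.2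
    exact ⟨⟨ℓ', h1, h3⟩, N, h2, h4, h5, h6 μ inferInstance hμ⟩
  choose next N hNm hlow hhigh hNμ using hnext
  let A : ∀ n, L n := fun n => Nat.rec ℓ₀ (fun n ℓ => next n ℓ) n
  let B : ℕ → Set Z := fun n => N n (A n)
  have hA0 : ∀ z k, ((A 0).1 z k).1 = ψ z k.unpair.1 := fun _ _ => rfl
  have hAlow : ∀ n, ∀ z ∉ B n, ∀ k < n, (A (n + 1)).1 z k = (A n).1 z k := fun n => hlow n (A n)
  have hAhigh : ∀ n z, ∀ k ≥ n, ((A (n + 1)).1 z k).1 = ((A n).1 z k).1 := fun n => hhigh n (A n)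
  have hBμ : ∀ n, μ (B n) ≤ 2⁻¹ ^ n := by
    intro n
    have h := hNμ n (A n)
    rw [← ENNReal.inv_pow]
    exact ENNReal.le_inv_iff_mul_le.2 (by rwa [mul_comm])
  -- By Borel-Cantelli almost every orbit is eventually left alone.
  let Z' : Set Z := {z | ∀ g : G, ∀ᶠ n in atTop, g • z ∉ B n}
  have hZ'm : MeasurableSet Z' := by
    have : Z' = ⋂ g : G, ⋃ m : ℕ, ⋂ n ∈ Set.Ici m, (fun z => g • z) ⁻¹' (B n)ᶜ := by
      ext z; simp [Z', eventually_atTop]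
    rw [this]
    exact MeasurableSet.iInter fun g => MeasurableSet.iUnion fun m =>
      MeasurableSet.biInter (Set.to_countable _) fun n _ => hmeas g (hNm n (A n)).compl
  have hZ'ae : ∀ᵐ z ∂μ, z ∈ Z' := by
    refine ae_all_iff.2 fun g => ?_
    refine ae_eventually_notMem (s := fun n => (fun z => g • z) ⁻¹' B n) (ne_top_of_le_ne_top
      (b := ∑' n : ℕ, (2⁻¹ : ENNReal) ^ n) ?_ (ENNReal.tsum_le_tsum fun n => ?_))
    · simp [ENNReal.tsum_geometric, ENNReal.one_sub_inv_two]
    · rw [(hμ g).measure_preimage (hNm n (A n)).nullMeasurableSet]; exact hBμ n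
  have hZ'smul : ∀ g : G, ∀ z ∈ Z', g • z ∈ Z' := by
    intro g z hz h
    simpa only [mul_smul] using hz (h * g)
  have hconst : ∀ z ∈ Z', ∀ (g : G) (k : ℕ), ∃ c, ∀ᶠ n in atTop, (A n).1 (g • z) k = c := by
    intro z hz g k
    obtain ⟨m, hm⟩ := eventually_atTop.1 ((hz g).and (eventually_gt_atTop k))
    refine ⟨(A m).1 (g • z) k, eventually_atTop.2 ⟨m, fun n hn => ?_⟩⟩
    induction n, hn using Nat.le_induction with
    | base => rfl
    | succ n hn ih => rw [hAlow n _ (hm n hn).1 k (hm n hn).2, ih]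
  let Φ : ℕ → Z → Config G := fun n z => if z ∈ Z' then orbitMap (A n).1 z else y₀
  have hΦm : ∀ n, Measurable (Φ n) := fun n =>
    Measurable.ite hZ'm (measurable_orbitMap hmeas (A n).2.1) measurable_const
  have hΦX : ∀ m n z, m ≤ n → Φ n z ∈ X m := by
    intro m n z hmn
    by_cases h : z ∈ Z'
    · simp only [Φ, if_pos h]; exact hanti hmn ((A n).2.2 z)
    · simp only [Φ, if_neg h]; exact hy₀ m
  have hlim : ∀ z, ∃ x, Tendsto (fun n => Φ n z) atTop (𝓝 x) := by
    intro z
    by_cases h : z ∈ Z'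
    · choose c hc using hconst z h
      refine ⟨c, ?_⟩
      simp only [Φ, if_pos h]
      exact tendsto_pi_nhds.2 fun g => tendsto_pi_nhds.2 fun k =>
        tendsto_const_nhds.congr' ((hc g k).mono fun n hn => hn.symm)
    · simp only [Φ, if_neg h]
      exact ⟨y₀, tendsto_const_nhds⟩
  choose f hf using hlim
  refine ⟨Z', f, hZ'm, hZ'ae, hZ'smul,
    measurable_of_tendsto_metrizable hΦm (tendsto_pi_nhds.2 hf), ?_, ?_, ?_⟩
  · intro z m
    obtain ⟨V, E, hm⟩ := hX m
    exact hm.isClosed.mem_of_tendsto (hf z) (eventually_atTop.2 ⟨m, fun n hn => hΦX m n z hn⟩)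
  · intro g z hz
    refine tendsto_nhds_unique (hf (g • z)) (((hf z).const_smul g).congr fun n => ?_)
    simp only [Φ, if_pos hz, if_pos (hZ'smul g z hz), smul_orbitMap]
  · -- From some track on, the data at the position `1` are those of the initial label.
    have hdata : ∀ z ∈ Z', ∃ m, ∀ k ≥ m, (f z 1 k).1 = ψ z k.unpair.1 := by
      intro z hz
      obtain ⟨m, hm⟩ := eventually_atTop.1 (hz 1)
      refine ⟨m, fun k hk => ?_⟩
      have h : ∀ n, ((A n).1 z k).1 = ψ z k.unpair.1 := by
        intro n
        induction n with
        | zero => exact hA0 z k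
        | succ n ih =>
          rcases le_or_gt n k with hnk | hnk
          · rw [hAhigh n z k hnk, ih]
          · have := hm n (hk.trans hnk.le)
            rw [one_smul] at this
            rw [hAlow n z this k hnk, ih]
      have h1 : Tendsto (fun n => (Φ n z 1 k).1) atTop (𝓝 (f z 1 k).1) :=
        ((continuous_fst.comp (continuous_config_apply 1 k)).tendsto (f z)).comp (hf z)
      have h2 : ∀ n, (Φ n z 1 k).1 = ψ z k.unpair.1 := by
        intro n
        simp only [Φ, if_pos hz, orbitMap, one_smul, h]
      simp only [h2] at h1
      exact tendsto_nhds_unique h1 tendsto_const_nhds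
    intro z hz z' hz' hzz'
    obtain ⟨m, hm⟩ := hdata z hz
    obtain ⟨m', hm'⟩ := hdata z' hz'
    refine hψ (funext fun j => ?_)
    have h1 := hm (Nat.pair j (max m m')) ((le_max_left _ _).trans (Nat.right_le_pair _ _))
    have h2 := hm' (Nat.pair j (max m m')) ((le_max_right _ _).trans (Nat.right_le_pair _ _))
    rw [Nat.unpair_pair] at h1 h2
    rw [← h1, ← h2, hzz']

/-- A flow `A` that is the intersection of successive refinements is model-universal. -/
theorem modelUniversal_of_refines {X : ℕ → Set (Config G)} (hX : ∀ n, ∃ V E, IsStage n V E (X n))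
    (hX0 : X 0 = Set.univ) (href : ∀ n, Refines.{u, w} n n (X n) (X (n + 1)))
    {A : GFlow.{u, 0} G} {ev : A.carrier → Config G} (hne : Nonempty A.carrier)
    (hev : IsClosedEmbedding ev) (hrange : Set.range ev = ⋂ n, X n)
    (hsmul : ∀ (g : G) (a : A.carrier), ev (g • a) = g • ev a) :
    GFlow.ModelUniversal.{u, 0, w} A := by
  have : TopologicalSpace.MetrizableSpace A.carrier := hev.isEmbedding.metrizableSpace
  have : PolishSpace A.carrier := by
    have : PolishSpace (Config G) := inferInstanceAs (PolishSpace (G → ℕ → Bool × Bool))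
    exact hev.polishSpace
  refine ⟨inferInstance, fun X₀ _ _ μ hμ => ?_⟩
  have := hμ.standardBorel
  have := hμ.isProbabilityMeasure
  have hpres := hμ.measurePreserving
  obtain ⟨a₀⟩ := hne
  -- Restrict to the free part.
  let S : SubMulAction G X₀ :=
    { carrier := {x | ∀ g : G, g • x = x → g = 1}
      smul_mem' := by
        intro h x hx g hg
        have := hx (h⁻¹ * g * h) (by
          rw [mul_smul, mul_smul, hg, inv_smul_smul])
        rwa [mul_assoc, inv_mul_eq_one, eq_comm, mul_eq_right] at this }
  have hSm : MeasurableSet (S : Set X₀) := by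
    have : (S : Set X₀) = ⋂ g : G, ⋂ _ : g ≠ 1, {x | g • x = x}ᶜ := by
      ext x
      simp only [Set.mem_iInter, Set.mem_compl_iff, Set.mem_ofPred_eq]
      exact forall_congr' fun g => not_imp_not.symm
    rw [this]
    exact MeasurableSet.iInter fun g => MeasurableSet.iInter fun _ =>
      (measurableSet_eq_fun (hpres g).measurable measurable_id).compl
  have hSae : ∀ᵐ x ∂μ, x ∈ S := by
    filter_upwards [hμ.ae_stabilizer_eq_bot] with x hx g hg
    have : g ∈ MulAction.stabilizer G x := hg
    rwa [hx, Subgroup.mem_bot] at this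
  have : StandardBorelSpace S := hSm.standardBorel
  have hemb : MeasurableEmbedding ((↑) : S → X₀) := MeasurableEmbedding.subtype_coe hSm
  let ν : Measure S := μ.comap (↑)
  have hSrange : Set.range ((↑) : S → X₀) = S := Subtype.range_coe
  have : IsProbabilityMeasure ν := ⟨by
    rw [hemb.comap_apply, Set.image_univ, hSrange]
    exact (mem_ae_iff_prob_eq_one hSm).1 hSae⟩
  have hmeas : ∀ g : G, Measurable fun z : S => g • z := fun g =>
    ((hpres g).measurable.comp measurable_subtype_coe).subtype_mk
  have hν : ∀ g : G, MeasurePreserving (fun z : S => g • z) ν ν := by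
    intro g
    refine ⟨hmeas g, Measure.ext fun B hB => ?_⟩
    rw [Measure.map_apply (hmeas g) hB, hemb.comap_apply, hemb.comap_apply,
      ← (hpres g).measure_preimage (hemb.measurableSet_image.2 hB).nullMeasurableSet]
    congr 1
    ext x
    constructor
    · rintro ⟨z, hz, rfl⟩
      exact ⟨g • z, hz, rfl⟩
    · rintro ⟨z, hz, hzx⟩
      refine ⟨g⁻¹ • z, by simpa using hz, ?_⟩
      have : ((g⁻¹ • z : S) : X₀) = g⁻¹ • (z : X₀) := rfl
      rw [this, hzx, inv_smul_smul]
  have hfree : ∀ (z : S) (g : G), g • z = z → g = 1 := fun z g h =>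
    z.2 g (congrArg Subtype.val h)
  have hy₀ : ∀ n, ev a₀ ∈ X n := Set.mem_iInter.1 (hrange ▸ Set.mem_range_self a₀)
  obtain ⟨Z', f, hZ'm, hZ'ae, hZ'smul, hfm, hfX, hfsmul, hfinj⟩ :=
    exists_measurable_injOn hX hX0 href hy₀ hmeas hfree ν hν
  have hfA : ∀ z, ∃ a, ev a = f z := fun z => by
    have : f z ∈ Set.range ev := hrange ▸ Set.mem_iInter.2 (hfX z)
    exact this
  choose fA hfA using hfA
  have hfAm : Measurable fA := by
    rw [← hev.measurableEmbedding.measurable_comp_iff]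
    have : ev ∘ fA = f := funext hfA
    rwa [this]
  obtain ⟨F, hFm, hF⟩ := hemb.exists_measurable_extend hfAm fun _ => ⟨a₀⟩
  have hF : ∀ z : S, F z = fA z := congrFun hF
  let X' : Set X₀ := (↑) '' Z'
  have hX'm : MeasurableSet X' := hemb.measurableSet_image.2 hZ'm
  have hX'1 : μ X' = 1 := by
    rw [← hemb.comap_apply]
    exact (mem_ae_iff_prob_eq_one hZ'm).1 hZ'ae
  have hX'ae : ∀ᵐ x ∂μ, x ∈ X' := (mem_ae_iff_prob_eq_one hX'm).2 hX'1
  have hX'F : ∀ g : G, ∀ x ∈ X', F (g • x) = g • F x := by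
    rintro g _ ⟨z, hz, rfl⟩
    have : g • (z : X₀) = ((g • z : S) : X₀) := rfl
    rw [this, hF, hF]
    apply hev.injective
    rw [hsmul, hfA, hfA, hfsmul g z hz]
  refine ⟨μ.map F, ⟨standardBorel_of_polish, Measure.isProbabilityMeasure_map hFm.aemeasurable,
    fun g => ?_⟩, X', F, hX'm, hX'1, ?_, hFm, hX'F, ?_, rfl⟩
  · have hg : Measurable fun a : A.carrier => g • a := (continuous_const_smul g).measurable
    refine ⟨hg, ?_⟩
    rw [Measure.map_map hg hFm]
    have h1 : (fun a => g • a) ∘ F =ᵐ[μ] F ∘ fun x => g • x :=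
      hX'ae.mono fun x hx => (hX'F g x hx).symm
    rw [Measure.map_congr h1, ← Measure.map_map hFm (hpres g).measurable, (hpres g).map_eq]
  · rintro g _ ⟨z, hz, rfl⟩
    exact ⟨g • z, hZ'smul g z hz, rfl⟩
  · rintro _ ⟨z, hz, rfl⟩ _ ⟨z', hz', rfl⟩ h
    rw [hF, hF] at h
    have : f z = f z' := by rw [← hfA, ← hfA, h]
    rw [hfinj hz hz' this]

end Universal

/-! ### The family of flows -/

theorem GFlow.isMinimal_of_isMinimal_pi {G : Type u} [Group G] {I : Type w}
    {Y : I → GFlow.{u, v} G} (h : (GFlow.pi Y).IsMinimal) (i : I) : (Y i).IsMinimal := by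
  classical
  obtain ⟨⟨y₀⟩, hd⟩ := h
  refine ⟨⟨y₀ i⟩, fun a => ?_⟩
  have hsurj : Function.Surjective fun y : (GFlow.pi Y).carrier => y i := fun b =>
    ⟨Function.update y₀ i b, Function.update_self i b y₀⟩
  have hcont : Continuous fun y : (GFlow.pi Y).carrier => y i := continuous_apply i
  have := hsurj.denseRange.dense_image hcont (hd (Function.update y₀ i a))
  refine this.mono ?_
  rintro _ ⟨_, ⟨g, rfl⟩, rfl⟩
  exact ⟨g, congrArg (g • ·) (Function.update_self i a y₀).symm⟩

theorem theorem3 (G : Type u) [Group G] [Countable G] [Infinite G]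
    (I : Type v) (hI : Cardinal.mk I = Cardinal.continuum) :
    ∃ Y : I → GFlow.{u, 0} G,
      GFlow.MutuallyDisjoint Y ∧
      ∀ i, (Y i).IsFree ∧ (Y i).IsMinimal ∧ GFlow.ModelUniversal.{u, 0, w} (Y i) := by
  classical
  obtain ⟨b⟩ : Nonempty (I ≃ (ℕ → Bool)) := by
    refine Cardinal.lift_mk_eq'.1 ?_
    rw [hI]
    simp
  obtain ⟨e, he⟩ := exists_surjective_nat G
  obtain ⟨X, hX, hX0, href, hjoint, hγ⟩ := exists_tree.{u, w} e
  have hclosed : ∀ n σ, IsClosed (X n σ) := fun n σ =>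
    (hX n σ).choose_spec.choose_spec.isClosed
  choose A ev hev hrange hsmul using fun σ =>
    exists_flow (Y := ⋂ n, X n σ) (isClosed_iInter fun n => hclosed n σ)
      (fun x hx g => Set.mem_iInter.2 fun n =>
        (hX n σ).choose_spec.choose_spec.smul_mem x (Set.mem_iInter.1 hx n) g)
  have hevX : ∀ σ (a : (A σ).carrier) n, ev σ a ∈ X n σ := fun σ a =>
    Set.mem_iInter.1 (hrange σ ▸ Set.mem_range_self a)
  have hne : ∀ σ, Nonempty (A σ).carrier := by
    intro σ
    obtain ⟨x, hx⟩ := IsCompact.nonempty_iInter_of_sequence_nonempty_isCompact_isClosed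
      (fun n => X n σ) (fun n => (href n σ).1)
      (fun n => (hX n σ).choose_spec.choose_spec.nonempty) (hclosed 0 σ).isCompact
      (fun n => hclosed n σ)
    obtain ⟨a, -⟩ : x ∈ Set.range (ev σ) := (hrange σ).symm ▸ hx
    exact ⟨a⟩
  have hpi : (GFlow.pi fun i => A (b i)).IsMinimal := by
    refine ⟨⟨fun i => (hne (b i)).some⟩, fun y => ?_⟩
    refine dense_iff_inter_open.2 fun U hU ⟨x, hx⟩ => ?_
    obtain ⟨J, u, hu, huU⟩ := isOpen_pi_iff.1 hU x hx
    have hn : ∀ i ∈ J, ∃ n, ∀ a : (A (b i)).carrier,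
        (∀ j < n, ∀ k < n, ev _ a (e j) k = ev _ (x i) (e j) k) → a ∈ u i := by
      intro i hi
      obtain ⟨O, hO, hOu⟩ := (hev (b i)).isInducing.isOpen_iff.1 (hu i hi).1
      have hxO : ev _ (x i) ∈ O := by
        have := (hu i hi).2
        rw [← hOu] at this
        exact this
      obtain ⟨n, hn⟩ := exists_agree_subset he hO hxO
      exact ⟨n, fun a ha => by rw [← hOu]; exact hn _ ha⟩
    choose! n hn using hn
    -- Beyond some level the branches of the coordinates in `J` are separated.
    have hsep : ∀ i j, ∃ m, (∀ k < m, b i k = b j k) → b i = b j := by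
      intro i j
      by_cases h : b i = b j
      · exact ⟨0, fun _ => h⟩
      · obtain ⟨k, hk⟩ := Function.ne_iff.1 h
        exact ⟨k + 1, fun h' => absurd (h' k k.lt_succ_self) hk⟩
    choose m hm using hsep
    let N := 2 * (J.sup n + J.sup fun i => J.sup (m i))
    have hnN : ∀ i ∈ J, n i ≤ N := fun i hi => by
      have := Finset.le_sup (f := n) hi
      omega
    have hmN : ∀ i ∈ J, ∀ j ∈ J, m i j ≤ N := fun i hi j hj => by
      have h1 := Finset.le_sup (f := fun i => J.sup (m i)) hi
      have h2 := Finset.le_sup (f := m i) hj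
      omega
    obtain ⟨t, ht⟩ := hjoint N (even_two_mul _) (J.image b) (by
        intro σ hσ τ hτ h
        obtain ⟨i, hi, rfl⟩ := Finset.mem_image.1 hσ
        obtain ⟨j, hj, rfl⟩ := Finset.mem_image.1 hτ
        exact hm i j fun k hk => h k (hk.trans_le (hmN i hi j hj)))
      (fun σ => ev _ (x (b.symm σ))) (fun σ => ev _ (y (b.symm σ)))
      (fun σ _ => by simpa using hevX _ (x (b.symm σ)) N)
      (fun σ _ => by simpa using hevX _ (y (b.symm σ)) (N + 1))
    refine ⟨t • y, huU fun i hi => hn i hi _ fun j hj k hk => ?_, ⟨t, rfl⟩⟩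
    have h1 := ht (b i) (Finset.mem_image_of_mem b hi) j (hj.trans_le (hnN i hi)) k
      (hk.trans_le (hnN i hi))
    have h2 : ∀ z : ∀ i, (A (b i)).carrier,
        ev (b (b.symm (b i))) (z (b.symm (b i))) = ev (b i) (z i) := fun z => by
      rw [b.symm_apply_apply]
    rw [h2 x, h2 y] at h1
    change ev (b i) (t • y i) (e j) k = _
    rw [hsmul, Config.smul_apply]
    exact h1
  have hmin := fun i => GFlow.isMinimal_of_isMinimal_pi hpi i
  refine ⟨fun i => A (b i), ⟨hmin, hpi⟩, fun i => ⟨fun a g hg hga => ?_, hmin i, ?_⟩⟩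
  · obtain ⟨j, rfl⟩ := he g
    have hj : (2 * j + 1) / 2 = j := by omega
    refine hγ (2 * j + 1) (odd_two_mul_add_one j) (by rwa [hj]) (b i) (ev _ a) (hevX _ a _) ?_
    rw [hj, ← hsmul, hga]
  · exact modelUniversal_of_refines (fun n => hX n (b i)) (hX0 (b i)) (fun n => href n (b i))
      (hne (b i)) (hev (b i)) (hrange (b i)) (hsmul (b i))
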